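/- **Setting.** A bandit has arms $a\in\{1,\dots,n\}$. Pulling arm $a$ draws $(M,Y,O^M,O^Y)$ from a fixed law $\mathbb P(\cdot\mid a)$, independently of the past given the arm. Here $M$ (the mediator) takes $K$ values, $Y$ (the reward) takes $L$ distinct real values, all in $[-1,1]$ (for instance, normalized so that $\sum_{y}|y|=1$), and $O^M,O^Y\in\{0,1\}$. The agent sees $M$ iff $O^M=1$ and $Y$ iff $O^Y=1$ (and sees $O^M,O^Y$). Put $p_{m,a}=\mathbb P(M=m\mid a)$, $\lambda_{m,a}=\mathbb P(O^M=1\mid m,a)$, $\gamma_{m,a}=\mathbb P(O^Y=1\mid m,a)$, $\lambda_a=\min_m\lambda_{m,a}$, $\mu_a=\mathbb E[Y\mid a]$, and let $$\Theta_a=[\mathbb P(m,y,O^M=1,O^Y=1\mid a)]_{m,y}\in\mathbb R^{K\times L}.$$ Norms of matrices are the $\infty$-operator norm (maximal absolute row sum), $A^\dagger$ is the Moore–Penrose pseudo-inverse, and $\kappa(A)=\|A\|_\infty\|A^\dagger\|_\infty$. The regret of a policy that pulls $a_1,\dots,a_T$ is $R_T=\sum_{t=1}^T(\max_a\mu_a-\mu_{a_t})$.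 **Assumptions.** For every arm $a$: (i) $p_{m,a}>0$ and $\gamma_{m,a}>0$ for all $m$; (ii) $Y,O^Y,O^M$ are mutually independent given $(A,M)$; (iii) (completeness) if $g$ is a real function of the mediator with $\sum_m \mathbb P(m,y,O^M=1,O^Y=1\mid a)\,g(m)=0$ for every $y$, then $g(M)=0$ almost surely; (iv) $\kappa(\Theta_a)\le C_a$, where the numbers $C_a$ are known to the agent. **Algorithm** (two-step UCB, inputs $T$, $\alpha$, $(C_a)$). First pull the arms one after the other, $\lceil(\log T)^2\rceil$ times each. Then, in every round, pull an arm with the largest $\mathrm{UCB}(a)$ (ties broken arbitrarily), computed from the observations so far as follows. Let $T_a$ be the number of pulls of $a$, and let $\hat\Theta_a$, $\hat b_a$, $\hat q_{m,a}$ be the empirical frequencies among these pulls that estimate $\Theta_a$, $[\mathbb P(Y=y,O^M=0,O^Y=1\mid a)]_y$ and $\mathbb P(M=m,O^M=1\mid a)$. Let $T_{a,m,o_Y}$ be the number of pulls of $a$ with $M=m$ and $O^M=O^Y=1$, and $\hat\mu_{m,a}$ the average of $Y$ over those pulls. Step one: $\hat x_a=(\hat\Theta_a^{\top})^\dagger\hat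 b_a$ (the estimated inverse odds ratios $\mathbb P(O^M=0\mid m,a)/\mathbb P(O^M=1\mid m,a)$), $\hat\lambda_a=1/\max_m(1+\hat x_a(m))$, $\hat p_{m,a}=(1+\hat x_a(m))\,\hat q_{m,a}$. Step two: $\hat\mu_a=\sum_m\hat p_{m,a}\hat\mu_{m,a}$ and $$\mathrm{UCB}(a)=\hat\mu_a+2\sqrt{\frac{\alpha\log T}{2T_a}}\left(8\frac{C_a}{\|\hat\Theta_a\|_\infty}\frac{K}{\hat\lambda_a}+\frac1{\hat\lambda_a}\right)+\sqrt{\frac{\alpha\log T}{2}\sum_m\frac{4\hat p_{m,a}^2}{T_{a,m,o_Y}}}$$ (a quotient with denominator $0$ is read as $0$). **Theorem.** There is a universal constant $c>0$ such that for every such bandit and all such $(C_a)$, every $\alpha>1$ and every sufficiently large $T$ (depending on the bandit, on $(C_a)$ and on $\alpha$), the algorithm satisfies $$\mathbb E[R_T]\le c\,\sqrt{\alpha\,T\log T\sum_a S_a^2},\qquad S_a=\max\left(32\frac{C_a}{\|\Theta_a\|_\infty}\frac K{\lambda_a}+\frac2{\lambda_a},\ \sqrt{\sum_m\frac{32\,p_{m,a}}{\lambda_{m,a}\gamma_{m,a}}}\right).$$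 -/

import Mathlib

open scoped Matrix BigOperators

namespace MissingBandit

/-! ### The Moore-Penrose pseudo-inverse and the condition number of a real matrix -/

section LinearAlgebra

variable {m n : Type*} [Fintype m] [Fintype n]

/-- The four Penrose equations: `X` is a pseudo-inverse of the real matrix `A`. -/
structure IsPseudoInverse (A : Matrix m n ℝ) (X : Matrix n m ℝ) : Prop where
  left_reproduce : A * X * A = A
  right_reproduce : X * A * X = X
  left_symm : (A * X)ᵀ = A * X
  right_symm : (X * A)ᵀ = X * A

theorem IsPseudoInverse.unique {A : Matrix m n ℝ} {X Z : Matrix n m ℝ}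
    (hX : IsPseudoInverse A X) (hZ : IsPseudoInverse A Z) : X = Z := by
  have h1 : A * X = A * Z := by
    calc A * X = (A * Z * A) * X := by rw [hZ.left_reproduce]
      _ = (A * Z)ᵀ * (A * X)ᵀ := by rw [hZ.left_symm, hX.left_symm, Matrix.mul_assoc (A * Z)]
      _ = (A * X * A * Z)ᵀ := by rw [← Matrix.transpose_mul, Matrix.mul_assoc (A * X)]
      _ = A * Z := by rw [hX.left_reproduce, hZ.left_symm]
  have h2 : X * A = Z * A := by
    calc X * A = X * (A * Z * A) := by rw [hZ.left_reproduce]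
      _ = (X * A)ᵀ * (Z * A)ᵀ := by
        rw [hX.right_symm, hZ.right_symm]; simp only [Matrix.mul_assoc]
      _ = (Z * (A * X * A))ᵀ := by
        rw [← Matrix.transpose_mul]; simp only [Matrix.mul_assoc]
      _ = Z * A := by rw [hX.left_reproduce, hZ.right_symm]
  calc X = X * A * X := hX.right_reproduce.symm
    _ = Z * A * X := by rw [h2]
    _ = Z * (A * Z) := by rw [Matrix.mul_assoc, h1]
    _ = Z := by rw [← Matrix.mul_assoc, hZ.right_reproduce]

theorem exists_isPseudoInverse (A : Matrix m n ℝ) : ∃ X, IsPseudoInverse A X := by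
  classical
  have hH : (Aᵀ * A).IsHermitian := by
    simp [Matrix.IsHermitian, Matrix.conjTranspose_eq_transpose_of_trivial]
  obtain ⟨U, hU1, d, hd⟩ : ∃ U : Matrix n n ℝ, Uᵀ * U = 1 ∧
      ∃ d : n → ℝ, Aᵀ * A = U * Matrix.diagonal d * Uᵀ := by
    refine ⟨hH.eigenvectorUnitary, ?_, hH.eigenvalues, ?_⟩
    · have := Matrix.UnitaryGroup.star_mul_self hH.eigenvectorUnitary
      rwa [Matrix.star_eq_conjTranspose, Matrix.conjTranspose_eq_transpose_of_trivial] at this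
    · have := hH.spectral_theorem
      rw [Unitary.conjStarAlgAut_apply] at this
      rw [Matrix.star_eq_conjTranspose, Matrix.conjTranspose_eq_transpose_of_trivial] at this
      exact this
  let e : n → ℝ := fun i => (d i)⁻¹
  let G : Matrix n n ℝ := U * Matrix.diagonal e * Uᵀ
  have hmul : ∀ f g : n → ℝ, (U * Matrix.diagonal f * Uᵀ) * (U * Matrix.diagonal g * Uᵀ)
      = U * Matrix.diagonal (fun i => f i * g i) * Uᵀ := by
    intro f g
    calc _ = U * Matrix.diagonal f * (Uᵀ * U) * Matrix.diagonal g * Uᵀ := by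
          simp only [Matrix.mul_assoc]
      _ = _ := by
          rw [hU1, Matrix.mul_one, Matrix.mul_assoc U, Matrix.diagonal_mul_diagonal]
  have hsym : ∀ f : n → ℝ, (U * Matrix.diagonal f * Uᵀ)ᵀ = U * Matrix.diagonal f * Uᵀ := by
    intro f
    simp [Matrix.transpose_mul, Matrix.mul_assoc]
  have hGS : G * (Aᵀ * A) = U * Matrix.diagonal (fun i => e i * d i) * Uᵀ := by
    rw [hd]; exact hmul e d
  have hGSG : G * (Aᵀ * A) * G = G := by
    rw [hGS]; refine (hmul _ _).trans ?_
    congr 3; funext i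
    by_cases h : d i = 0 <;> simp [e, h]
  have hSGS : Aᵀ * A * (G * (Aᵀ * A)) = Aᵀ * A := by
    rw [hGS, hd]; refine (hmul _ _).trans ?_
    congr 3; funext i
    by_cases h : d i = 0 <;> simp [e, h]
  have hAGS : A * (G * (Aᵀ * A)) = A := by
    have h0 : Aᵀ * A * (G * (Aᵀ * A) - 1) = 0 := by
      rw [Matrix.mul_sub, hSGS, Matrix.mul_one, sub_self]
    have h1 := (Matrix.conjTranspose_mul_self_mul_eq_zero A (G * (Aᵀ * A) - 1)).1
      (by rw [Matrix.conjTranspose_eq_transpose_of_trivial]; exact h0)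
    rw [Matrix.mul_sub, Matrix.mul_one] at h1
    exact sub_eq_zero.1 h1
  refine ⟨G * Aᵀ, ⟨?_, ?_, ?_, ?_⟩⟩
  · simpa only [Matrix.mul_assoc] using hAGS
  · calc G * Aᵀ * A * (G * Aᵀ) = (G * (Aᵀ * A) * G) * Aᵀ := by simp only [Matrix.mul_assoc]
      _ = G * Aᵀ := by rw [hGSG]
  · have hG : Gᵀ = G := hsym e
    simp [Matrix.transpose_mul, hG, Matrix.mul_assoc]
  · rw [Matrix.mul_assoc, hGS]; exact hsym _

/-- The Moore-Penrose pseudo-inverse `A†`. -/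
noncomputable def pinv (A : Matrix m n ℝ) : Matrix n m ℝ := (exists_isPseudoInverse A).choose

theorem pinv_spec (A : Matrix m n ℝ) : IsPseudoInverse A (pinv A) :=
  (exists_isPseudoInverse A).choose_spec

attribute [local instance] Matrix.linftyOpNormedAddCommGroup in
/-- The matrix norm induced by the `∞`-norm (the maximal absolute row sum). -/
noncomputable def infNorm (A : Matrix m n ℝ) : ℝ := ‖A‖

/-- The condition number with respect to the `∞`-norm. -/
noncomputable def condNumber (A : Matrix m n ℝ) : ℝ := infNorm A * infNorm (pinv A)

end LinearAlgebra

/-! ### The bandit -/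

/-- One draw `(M, Y, O^M, O^Y)`. The mediator takes `K` values; the outcome is given by its index
among the `L` possible values; `true` means that the variable is observed. -/
abbrev Draw (K L : ℕ) : Type := Fin K × Fin L × Bool × Bool

/-- What the agent sees of a draw: `none` is the missing value `?`. -/
abbrev Obs (K L : ℕ) : Type := Option (Fin K) × Option (Fin L)

/-- `(M^o, Y^o)` for a draw `(M, Y, O^M, O^Y)`. -/
def observe {K L : ℕ} (x : Draw K L) : Obs K L :=
  (if x.2.2.1 then some x.1 else none, if x.2.2.2 then some x.2.1 else none)

/-- A bandit with `n` arms, a mediator with `K` values and an outcome with `L` real values;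
`law a` is the joint probability mass function of `(M, Y, O^M, O^Y)` given `A = a`. -/
structure Bandit (n K L : ℕ) where
  value : Fin L → ℝ
  value_injective : Function.Injective value
  law : Fin n → Draw K L → ℝ
  law_nonneg : ∀ a x, 0 ≤ law a x
  law_sum : ∀ a, ∑ x, law a x = 1

namespace Bandit

variable {n K L : ℕ} (B : Bandit n K L)

/-- `ℙ(E | A = a)`. -/
noncomputable def prob (a : Fin n) (E : Set (Draw K L)) : ℝ := ∑ x, E.indicator (B.law a) x

/-- `ℙ(E | M = m, A = a)`. -/
noncomputable def probGiven (a : Fin n) (m : Fin K) (E : Set (Draw K L)) : ℝ :=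
  B.prob a (E ∩ {x | x.1 = m}) / B.prob a {x | x.1 = m}

/-- `p_{m,a} = ℙ(M = m | A = a)`. -/
noncomputable def p (m : Fin K) (a : Fin n) : ℝ := B.prob a {x | x.1 = m}

/-- `λ_{m,a} = ℙ(O^M = 1 | M = m, A = a)`. -/
noncomputable def lam (m : Fin K) (a : Fin n) : ℝ := B.probGiven a m {x | x.2.2.1 = true}

/-- `γ_{m,a} = ℙ(O^Y = 1 | M = m, A = a)`. -/
noncomputable def gam (m : Fin K) (a : Fin n) : ℝ := B.probGiven a m {x | x.2.2.2 = true}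

/-- `λ_a = min_m λ_{m,a}`. -/
noncomputable def lamMin (a : Fin n) : ℝ := ⨅ m, B.lam m a

/-- `Θ_a = [ℙ(M = m, Y = y, O^M = 1, O^Y = 1 | A = a)]`, with `K` rows and `L` columns. -/
def Theta (a : Fin n) : Matrix (Fin K) (Fin L) ℝ := fun m j => B.law a (m, j, true, true)

/-- `μ_a = 𝔼[Y | A = a]`. -/
noncomputable def mean (a : Fin n) : ℝ := ∑ x, B.law a x * B.value x.2.1

/-- `max_a μ_a - μ_a`. -/
noncomputable def gap (a : Fin n) : ℝ := (⨆ a', B.mean a') - B.mean a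

/-- `ℙ(M = m | A = a)` and `ℙ(O^Y = 1 | M = m, A = a)` are positive. -/
def Positivity : Prop := ∀ a m, 0 < B.p m a ∧ 0 < B.gam m a

/-- `Y`, `O^Y` and `O^M` are mutually independent given `(A, M)`. -/
def IndepGivenMediator : Prop :=
  ∀ a m j (u v : Bool), 0 < B.p m a →
    B.probGiven a m {x | x.2.1 = j ∧ x.2.2.1 = u ∧ x.2.2.2 = v} =
      B.probGiven a m {x | x.2.1 = j} * B.probGiven a m {x | x.2.2.1 = u} *
        B.probGiven a m {x | x.2.2.2 = v}

/-- Completeness in `Y`: a function `g` of the mediator with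
`∑_m ℙ(M = m, Y = y, O^M = 1, O^Y = 1 | a) g(m) = 0` for every `y` has `g(M) = 0` almost surely. -/
def Complete : Prop :=
  ∀ a (g : Fin K → ℝ), (∀ j, ∑ m, B.Theta a m j * g m = 0) → ∀ m, 0 < B.p m a → g m = 0

/-- The complexity `S_a` for the bounds `C_a` on the condition numbers. -/
noncomputable def S (C : Fin n → ℝ) (a : Fin n) : ℝ :=
  max (32 * (C a / infNorm (B.Theta a)) * (K / B.lamMin a) + 2 / B.lamMin a)
    (√(∑ m, 32 * B.p m a / (B.lam m a * B.gam m a)))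

end Bandit

/-! ### The interaction of an agent with a bandit -/

/-- The observed past, in chronological order: arms with what was observed. -/
abbrev History (n K L : ℕ) : Type := List (Fin n × Obs K L)

/-- A policy chooses the next arm from the observed past. -/
abbrev Policy (n K L : ℕ) : Type := History n K L → Fin n

section Interaction

variable {n K L : ℕ}

/-- The history produced when the successive draws are the entries of the list. -/
def play (π : Policy n K L) (xs : List (Draw K L)) : History n K L :=
  xs.foldl (fun h x => h ++ [(π h, observe x)]) []

/-- The arm pulled in round `t` (counted from `0`) when the draws of the `T` rounds are `x`. -/
def arm (π : Policy n K L) {T : ℕ} (x : Fin T → Draw K L) (t : Fin T) : Fin n :=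
  π (play π ((List.ofFn x).take t))

/-- The probability that the draws of the `T` rounds are `x`: in each round, the draw has,
given the past, the law of the arm that is pulled. -/
def trajProb (B : Bandit n K L) (π : Policy n K L) {T : ℕ} (x : Fin T → Draw K L) : ℝ :=
  ∏ t, B.law (arm π x t) (x t)

/-- `𝔼[R_T]`, with `R_T = ∑_t (max_a μ_a - μ_{a_t})`. -/
noncomputable def expectedRegret (B : Bandit n K L) (π : Policy n K L) (T : ℕ) : ℝ :=
  ∑ x : Fin T → Draw K L, trajProb B π x * ∑ t, B.gap (arm π x t)

end Interaction

/-! ### The estimators and the algorithm -/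

section Algorithm

variable {n K L : ℕ} (h : History n K L) (a : Fin n)

/-- `T_a`, the number of pulls of `a`. -/
def pulls : ℕ := h.countP (fun e => e.1 = a)

/-- `Θ̂_a`, the empirical version of `Θ_a`. -/
noncomputable def ThetaHat : Matrix (Fin K) (Fin L) ℝ :=
  fun m j => (h.count (a, some m, some j) : ℝ) / pulls h a

/-- `b̂_a`, the empirical version of `[ℙ(Y = y, O^M = 0, O^Y = 1 | a)]`. -/
noncomputable def bHat : Fin L → ℝ :=
  fun j => (h.count (a, none, some j) : ℝ) / pulls h a

/-- The estimated inverse odds ratios `ℙ(O^M = 0 | m, a) / ℙ(O^M = 1 | m, a)`: the least squares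
solution, by the pseudo-inverse, of `∑_m Θ̂_a(m, y) x(m) = b̂_a(y)` for all `y`. -/
noncomputable def oddsHat : Fin K → ℝ := pinv (ThetaHat h a)ᵀ *ᵥ bHat h a

/-- `λ̂_a = 1 / max_m (1 + ÔR_{m,a})`. -/
noncomputable def lamHat : ℝ := 1 / ⨆ m, (1 + oddsHat h a m)

/-- `p̂_{m,a} = (1 + ÔR_{m,a}) ℙ̂(M = m, O^M = 1 | a)`. -/
noncomputable def pHat (m : Fin K) : ℝ :=
  (1 + oddsHat h a m) *
    ((h.countP (fun e => e.1 = a ∧ e.2.1 = some m) : ℝ) / pulls h a)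

/-- `T_{a,m,o_Y}`, the number of pulls of `a` in which `M = m` and the outcome were observed. -/
def pullsObs (m : Fin K) : ℕ := ∑ j : Fin L, h.count (a, some m, some j)

/-- `μ̂_{m,a}`, the mean of the outcomes observed together with `M = m` when `a` was pulled. -/
noncomputable def condMeanHat (y : Fin L → ℝ) (m : Fin K) : ℝ :=
  (∑ j, (h.count (a, some m, some j) : ℝ) * y j) / pullsObs h a m

/-- `μ̂_a = ∑_m p̂_{m,a} μ̂_{m,a}`. -/
noncomputable def meanHat (y : Fin L → ℝ) : ℝ := ∑ m, pHat h a m * condMeanHat h a y m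

/-- The upper confidence bound of the arm `a`. -/
noncomputable def ucb (y : Fin L → ℝ) (C : Fin n → ℝ) (α : ℝ) (T : ℕ) : ℝ :=
  meanHat h a y
    + 2 * √(α * Real.log T / (2 * pulls h a)) *
        (8 * (C a / infNorm (ThetaHat h a)) * (K / lamHat h a) + 1 / lamHat h a)
    + √(α * Real.log T / 2 * ∑ m, 4 * pHat h a m ^ 2 / pullsObs h a m)

end Algorithm

/-- The number of initial pulls of each arm, `log(T)^2` rounded up. -/
noncomputable def initPulls (T : ℕ) : ℕ := ⌈Real.log T ^ 2⌉₊

/-- `π` is the two-step UCB algorithm, for some way of breaking ties: the arms are first pulled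
one after the other, `initPulls T` times each; then an arm with maximal upper confidence bound
is pulled in every round. -/
structure IsTwoStepUCB {n K L : ℕ} (y : Fin L → ℝ) (C : Fin n → ℝ) (α : ℝ) (T : ℕ)
    (π : Policy n K L) : Prop where
  explore : ∀ h, h.length < n * initPulls T → (π h : ℕ) = h.length / initPulls T
  exploit : ∀ h, n * initPulls T ≤ h.length → ∀ a, ucb h a y C α T ≤ ucb h (π h) y C α T

end MissingBandit

/-!
For large `T` every quantity in the upper confidence bound of an arm is a function of `T_a` and of
the vector `v` of empirical frequencies of the possible observations, and after the exploration
rounds `v` is, up to an event of negligible probability, close to the law `P` of an observation.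

The true inverse odds ratios solve `Θᵀ x = b` (`Bandit.sum_Theta_mul_odds`), and completeness makes
`Θᵀ` injective, so `v ↦ (Θ(v)ᵀ)†` is continuous at `P`. Hence the two-step estimate of the mean has
at `P` the derivative `v ↦ ∑ v(o) ξ(o)` with an explicit influence function `ξ`
(`Bandit.isLittleO_meanOf_sub`). Writing `D = ‖Θ†‖`, the identity `Θ Θ† = 1` gives
`1 ≤ p λ γ D` (`Bandit.one_le_mul_infNorm_pinv`), so the noise of the second step, of order
`1 / (λ γ)`, is at most of order `D`, and the centered `ξ` is bounded by `4 D / λ_a`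
(`Bandit.abs_influence_sub_mean_le`). The first exploration bonus is at least
`8 (D / λ_a) √(2 α log T / T_a)`, up to a factor close to `1`. Thus deviations of `ξ` of
`(3 / 2) (4 D / λ_a) √(2 α log T / T_a)` are still covered by it, and an exponential supermartingale
(`trajE_exp_le_one`) shows that larger ones have probability at most `2 T^(-9 α / 4)` for each
round and each value of `T_a`. Since `α > 1`, a union bound over both costs only a constant regret.

Outside these events `μ_a ≤ UCB(a) ≤ μ_a + 3 S_a √(2 α log T / T_a)` (`Bandit.mean_le_ucb_le`), so
each round of the second phase costs at most `3 S_a √(2 α log T / T_a)` for the pulled arm `a`. The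
increments of the potential `∑ 2 S_a √T_a` dominate these costs, and the Cauchy-Schwarz inequality
bounds the potential by `2 √(T ∑ S_a²)`. The exploration rounds, of which there are
`O(log(T)²)`, are absorbed by taking `T` large.
-/

namespace MissingBandit

open Filter Topology Asymptotics

/-! ### The `∞`-operator norm and the pseudo-inverse -/

section MatrixFacts

variable {m n : Type*} [Fintype m] [Fintype n]

theorem sum_abs_row_le_infNorm (A : Matrix m n ℝ) (i : m) : ∑ j, |A i j| ≤ infNorm A := by
  have h : ∑ j, ‖A i j‖₊ ≤ Finset.univ.sup fun i => ∑ j, ‖A i j‖₊ :=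
    Finset.le_sup (f := fun i => ∑ j, ‖A i j‖₊) (Finset.mem_univ i)
  rw [infNorm, Matrix.linfty_opNorm_def]
  have h' := NNReal.coe_le_coe.2 h
  simpa [NNReal.coe_sum] using h'

theorem infNorm_le {A : Matrix m n ℝ} {c : ℝ} (hc : 0 ≤ c) (h : ∀ i, ∑ j, |A i j| ≤ c) :
    infNorm A ≤ c := by
  rw [infNorm, Matrix.linfty_opNorm_def]
  lift c to NNReal using hc
  refine NNReal.coe_le_coe.2 (Finset.sup_le fun i _ => ?_)
  rw [← NNReal.coe_le_coe]
  simpa [NNReal.coe_sum] using h i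

theorem infNorm_nonneg (A : Matrix m n ℝ) : 0 ≤ infNorm A := by
  rw [infNorm, Matrix.linfty_opNorm_def]
  exact NNReal.coe_nonneg _

theorem infNorm_eq_iSup [Nonempty m] (A : Matrix m n ℝ) : infNorm A = ⨆ i, ∑ j, |A i j| :=
  le_antisymm
    (infNorm_le (Real.iSup_nonneg fun _ => Finset.sum_nonneg fun _ _ => abs_nonneg _)
      fun i => le_ciSup (f := fun i => ∑ j, |A i j|) (Set.finite_range _).bddAbove i)
    (ciSup_le fun i => sum_abs_row_le_infNorm A i)

theorem pinv_transpose (A : Matrix m n ℝ) : pinv Aᵀ = (pinv A)ᵀ := by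
  have h := pinv_spec A
  refine (pinv_spec Aᵀ).unique ⟨?_, ?_, ?_, ?_⟩
  · simp only [← Matrix.transpose_mul, ← Matrix.mul_assoc, h.left_reproduce]
  · simp only [← Matrix.transpose_mul, ← Matrix.mul_assoc, h.right_reproduce]
  · simp only [← Matrix.transpose_mul, h.right_symm]
  · simp only [← Matrix.transpose_mul, h.left_symm]

variable [DecidableEq n]

/-- A matrix of full column rank has the pseudo-inverse `(AᵀA)⁻¹Aᵀ`. -/
theorem pinv_eq_of_det_ne_zero {A : Matrix m n ℝ} (h : (Aᵀ * A).det ≠ 0) :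
    pinv A = (Aᵀ * A)⁻¹ * Aᵀ := by
  have hu : IsUnit (Aᵀ * A).det := isUnit_iff_ne_zero.2 h
  have hone : (Aᵀ * A)⁻¹ * Aᵀ * A = 1 := by
    rw [Matrix.mul_assoc, Matrix.nonsing_inv_mul _ hu]
  refine (pinv_spec A).unique ⟨?_, ?_, ?_, ?_⟩
  · rw [Matrix.mul_assoc, hone, Matrix.mul_one]
  · rw [hone, Matrix.one_mul]
  · simp [Matrix.transpose_mul, Matrix.transpose_nonsing_inv, Matrix.mul_assoc]
  · rw [hone, Matrix.transpose_one]

theorem pinv_mul_self_of_det_ne_zero {A : Matrix m n ℝ} (h : (Aᵀ * A).det ≠ 0) :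
    pinv A * A = 1 := by
  rw [pinv_eq_of_det_ne_zero h, Matrix.mul_assoc,
    Matrix.nonsing_inv_mul _ (isUnit_iff_ne_zero.2 h)]

theorem det_gram_ne_zero {A : Matrix m n ℝ} (h : ∀ g, A *ᵥ g = 0 → g = 0) :
    (Aᵀ * A).det ≠ 0 := by
  intro hdet
  obtain ⟨g, hg, hg0⟩ := Matrix.exists_mulVec_eq_zero_iff.2 hdet
  rw [← Matrix.conjTranspose_eq_transpose_of_trivial,
    Matrix.conjTranspose_mul_self_mulVec_eq_zero] at hg0
  exact hg (h g hg0)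

theorem continuousAt_pinv {A : Matrix m n ℝ} (h : (Aᵀ * A).det ≠ 0) :
    ContinuousAt (fun X : Matrix m n ℝ => pinv X) A := by
  have hgram : Continuous fun X : Matrix m n ℝ => Xᵀ * X :=
    continuous_id.matrix_transpose.matrix_mul continuous_id
  have hdet : Continuous fun X : Matrix m n ℝ => (Xᵀ * X).det := hgram.matrix_det
  have hev : ∀ᶠ X in 𝓝 A, (Xᵀ * X).det ≠ 0 := hdet.continuousAt.eventually_ne h
  have hc : ContinuousAt
      (fun X : Matrix m n ℝ => ((Xᵀ * X).det⁻¹ • (Xᵀ * X).adjugate) * Xᵀ) A := by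
    have hadj : Continuous fun X : Matrix m n ℝ => (Xᵀ * X).adjugate * Xᵀ :=
      hgram.matrix_adjugate.matrix_mul continuous_id.matrix_transpose
    simp only [Matrix.smul_mul]
    exact (hdet.continuousAt.inv₀ h).smul hadj.continuousAt
  refine hc.congr ?_
  filter_upwards [hev] with X hX
  rw [pinv_eq_of_det_ne_zero hX, Matrix.inv_def, Ring.inverse_eq_inv']

end MatrixFacts

theorem continuousAt_iSup_of_finite {X ι : Type*} [TopologicalSpace X] [Fintype ι] [Nonempty ι]
    {f : X → ι → ℝ} {x : X} (h : ∀ i, ContinuousAt (fun z => f z i) x) :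
    ContinuousAt (fun z => ⨆ i, f z i) x := by
  simp only [← Finset.sup'_univ_eq_ciSup]
  exact ContinuousAt.finset_sup'_apply Finset.univ_nonempty fun i _ => h i

/-! ### The law of an observation -/

namespace Bandit

variable {n K L : ℕ} (B : Bandit n K L)

/-- `ℙ((M^o, Y^o) = o | A = a)`, the law of what the agent sees of one draw. -/
noncomputable def obsProb (a : Fin n) (o : Obs K L) : ℝ :=
  ∑ x, if observe x = o then B.law a x else 0

/-- `ℙ(Y = y_j | M = m, A = a)`. -/
noncomputable def cond (a : Fin n) (m : Fin K) (j : Fin L) : ℝ := B.probGiven a m {x | x.2.1 = j}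

/-- `𝔼[Y | M = m, A = a]`. -/
noncomputable def condMean (a : Fin n) (m : Fin K) : ℝ := ∑ j, B.cond a m j * B.value j

/-- The inverse odds ratio `ℙ(O^M = 0 | m, a) / ℙ(O^M = 1 | m, a)`. -/
noncomputable def odds (a : Fin n) (m : Fin K) : ℝ := (1 - B.lam m a) / B.lam m a

theorem sum_obsProb_mul (a : Fin n) (f : Obs K L → ℝ) :
    ∑ o, B.obsProb a o * f o = ∑ x, B.law a x * f (observe x) := by
  simp only [obsProb, Finset.sum_mul]
  rw [Finset.sum_comm]
  refine Finset.sum_congr rfl fun x _ => ?_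
  simp [ite_mul]

theorem sum_obsProb (a : Fin n) : ∑ o, B.obsProb a o = 1 := by
  simpa [B.law_sum] using B.sum_obsProb_mul a fun _ => 1

theorem obsProb_nonneg (a : Fin n) (o : Obs K L) : 0 ≤ B.obsProb a o :=
  Finset.sum_nonneg fun x _ => by split_ifs; exacts [B.law_nonneg a x, le_rfl]

theorem obsProb_le_one (a : Fin n) (o : Obs K L) : B.obsProb a o ≤ 1 := by
  rw [← B.sum_obsProb a]
  exact Finset.single_le_sum (fun o _ => B.obsProb_nonneg a o) (Finset.mem_univ o)

theorem obsProb_some_some (a : Fin n) (m : Fin K) (j : Fin L) :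
    B.obsProb a (some m, some j) = B.Theta a m j := by
  simp [obsProb, observe, Fintype.sum_prod_type, Theta, Prod.ext_iff, ite_and]

theorem obsProb_none_some (a : Fin n) (j : Fin L) :
    B.obsProb a (none, some j) = ∑ m, B.law a (m, j, false, true) := by
  simp [obsProb, observe, Fintype.sum_prod_type, Prod.ext_iff]

theorem sum_obsProb_some (a : Fin n) (m : Fin K) :
    ∑ o, B.obsProb a (some m, o) = ∑ j, ∑ v, B.law a (m, j, true, v) := by
  simp [obsProb, observe, Fintype.sum_prod_type, Prod.ext_iff, Fintype.sum_option,
    Finset.sum_add_distrib, ite_and, add_comm]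

theorem prob_nonneg (a : Fin n) (E : Set (Draw K L)) : 0 ≤ B.prob a E :=
  Finset.sum_nonneg fun x _ => Set.indicator_nonneg (fun x _ => B.law_nonneg a x) x

theorem probGiven_nonneg (a : Fin n) (m : Fin K) (E : Set (Draw K L)) : 0 ≤ B.probGiven a m E :=
  div_nonneg (B.prob_nonneg a _) (B.prob_nonneg a _)

theorem sum_probGiven {ι : Type*} [Fintype ι] [DecidableEq ι] (a : Fin n) (m : Fin K)
    (hp : 0 < B.p m a) (f : Draw K L → ι) : ∑ i, B.probGiven a m {x | f x = i} = 1 := by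
  have hsum : ∑ i, B.prob a ({x | f x = i} ∩ {x | x.1 = m}) = B.prob a {x | x.1 = m} := by
    simp only [prob]
    rw [Finset.sum_comm]
    refine Finset.sum_congr rfl fun x _ => ?_
    by_cases hx : x.1 = m <;> simp [Set.indicator_apply, hx]
  simp only [probGiven]
  rw [← Finset.sum_div, hsum]
  exact div_self hp.ne'

theorem sum_p (a : Fin n) : ∑ m, B.p m a = 1 := by
  simp only [p, prob]
  rw [Finset.sum_comm, ← B.law_sum a]
  exact Finset.sum_congr rfl fun x _ => by simp [Set.indicator_apply]

theorem cond_nonneg (a : Fin n) (m : Fin K) (j : Fin L) : 0 ≤ B.cond a m j :=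
  B.probGiven_nonneg a m _

variable {B}

theorem sum_cond (hpos : B.Positivity) (a : Fin n) (m : Fin K) : ∑ j, B.cond a m j = 1 :=
  B.sum_probGiven a m (hpos a m).1 fun x => x.2.1

theorem probGiven_mediator_missing (hpos : B.Positivity) (a : Fin n) (m : Fin K) :
    B.probGiven a m {x | x.2.2.1 = false} = 1 - B.lam m a := by
  have h := B.sum_probGiven a m (hpos a m).1 fun x => x.2.2.1
  rw [Fintype.sum_bool] at h
  rw [lam]
  linarith

/-- Conditional independence, as a factorization of the law of a draw. -/
theorem law_eq (hpos : B.Positivity) (hind : B.IndepGivenMediator) (a : Fin n) (m : Fin K)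
    (j : Fin L) (u v : Bool) :
    B.law a (m, j, u, v) = B.p m a * (B.cond a m j * B.probGiven a m {x | x.2.2.1 = u} *
      B.probGiven a m {x | x.2.2.2 = v}) := by
  have hp := (hpos a m).1
  rw [cond, ← hind a m j u v hp, probGiven, ← p, mul_div_cancel₀ _ hp.ne']
  have hset : {x : Draw K L | x.2.1 = j ∧ x.2.2.1 = u ∧ x.2.2.2 = v} ∩ {x | x.1 = m}
      = {(m, j, u, v)} := by
    ext ⟨m', j', u', v'⟩
    simp only [Set.mem_inter_iff, Set.mem_ofPred_eq, Set.mem_singleton_iff, Prod.mk.injEq]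
    tauto
  simp [prob, hset, Set.indicator_apply]

theorem Theta_eq (hpos : B.Positivity) (hind : B.IndepGivenMediator) (a : Fin n) (m : Fin K)
    (j : Fin L) : B.Theta a m j = B.p m a * B.lam m a * B.gam m a * B.cond a m j := by
  rw [Theta, law_eq hpos hind, lam, gam]
  ring

theorem lam_pos (hpos : B.Positivity) (hind : B.IndepGivenMediator) (hcomp : B.Complete)
    (a : Fin n) (m : Fin K) : 0 < B.lam m a := by
  refine lt_of_le_of_ne (B.probGiven_nonneg a m _) fun h0 => ?_
  have h0 : B.lam m a = 0 := h0.symm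
  -- A mediator value that is never seen gives a zero row of `Θ`.
  have := hcomp a (Pi.single m 1) (fun j => by
    simp [Pi.single_apply, Theta_eq hpos hind, h0]) m (hpos a m).1
  simp at this

theorem lam_le_one (hpos : B.Positivity) (a : Fin n) (m : Fin K) : B.lam m a ≤ 1 := by
  have := probGiven_mediator_missing hpos a m
  linarith [B.probGiven_nonneg a m {x | x.2.2.1 = false}]

theorem gam_le_one (hpos : B.Positivity) (a : Fin n) (m : Fin K) : B.gam m a ≤ 1 := by
  have h := B.sum_probGiven a m (hpos a m).1 fun x => x.2.2.2
  rw [Fintype.sum_bool] at h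
  rw [gam]
  linarith [B.probGiven_nonneg a m {x | x.2.2.2 = false}]

theorem p_le_one (hpos : B.Positivity) (a : Fin n) (m : Fin K) : B.p m a ≤ 1 := by
  rw [← B.sum_p a]
  exact Finset.single_le_sum (fun m _ => (hpos a m).1.le) (Finset.mem_univ m)

theorem sum_obsProb_some_eq (hpos : B.Positivity) (hind : B.IndepGivenMediator) (a : Fin n)
    (m : Fin K) : ∑ o, B.obsProb a (some m, o) = B.p m a * B.lam m a := by
  have h := B.sum_probGiven a m (hpos a m).1 fun x => x.2.2.2
  simp only [sum_obsProb_some, law_eq hpos hind, ← Finset.mul_sum, h, mul_one]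
  rw [← Finset.sum_mul, sum_cond hpos, one_mul, lam]

/-- The identity behind the first step of the algorithm: the inverse odds ratios `x` solve
`Θᵀ x = b`. -/
theorem sum_Theta_mul_odds (hpos : B.Positivity) (hind : B.IndepGivenMediator)
    (hcomp : B.Complete) (a : Fin n) (j : Fin L) :
    ∑ m, B.Theta a m j * B.odds a m = B.obsProb a (none, some j) := by
  rw [obsProb_none_some]
  refine Finset.sum_congr rfl fun m _ => ?_
  have hl := (lam_pos hpos hind hcomp a m).ne'
  rw [Theta_eq hpos hind, law_eq hpos hind, probGiven_mediator_missing hpos, odds, gam]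
  field_simp

theorem mean_eq (hpos : B.Positivity) (hind : B.IndepGivenMediator) (a : Fin n) :
    B.mean a = ∑ m, B.p m a * B.condMean a m := by
  rw [mean, Fintype.sum_prod_type]
  refine Finset.sum_congr rfl fun m _ => ?_
  have hu := B.sum_probGiven a m (hpos a m).1 fun x => x.2.2.1
  have hv := B.sum_probGiven a m (hpos a m).1 fun x => x.2.2.2
  rw [Fintype.sum_prod_type, condMean, Finset.mul_sum]
  refine Finset.sum_congr rfl fun j _ => ?_
  simp only [Fintype.sum_prod_type, law_eq hpos hind, ← Finset.sum_mul, ← Finset.mul_sum, hu, hv]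
  ring

theorem abs_condMean_le_one (hval : ∀ j, |B.value j| ≤ 1) (hpos : B.Positivity) (a : Fin n)
    (m : Fin K) : |B.condMean a m| ≤ 1 := by
  rw [← sum_cond hpos a m]
  refine (Finset.abs_sum_le_sum_abs _ _).trans (Finset.sum_le_sum fun j _ => ?_)
  rw [abs_mul, abs_of_nonneg (B.cond_nonneg a m j)]
  exact mul_le_of_le_one_right (B.cond_nonneg a m j) (hval j)

theorem abs_mean_le_one (hval : ∀ j, |B.value j| ≤ 1) (a : Fin n) : |B.mean a| ≤ 1 := by
  rw [← B.law_sum a]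
  refine (Finset.abs_sum_le_sum_abs _ _).trans (Finset.sum_le_sum fun x _ => ?_)
  rw [abs_mul, abs_of_nonneg (B.law_nonneg a x)]
  exact mul_le_of_le_one_right (B.law_nonneg a x) (hval _)

theorem gap_le_two (hval : ∀ j, |B.value j| ≤ 1) (a : Fin n) : B.gap a ≤ 2 := by
  have : Nonempty (Fin n) := ⟨a⟩
  have h1 : ⨆ a', B.mean a' ≤ 1 := ciSup_le fun a' => (abs_le.1 (abs_mean_le_one hval a')).2
  have h2 := (abs_le.1 (abs_mean_le_one hval a)).1
  rw [gap]
  linarith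

theorem nonempty_mediator (B : Bandit n K L) (a : Fin n) : Nonempty (Fin K) := by
  by_contra h
  have hK := not_nonempty_iff.1 h
  simpa using B.law_sum a

theorem one_div_lam_eq (hpos : B.Positivity) (hind : B.IndepGivenMediator) (hcomp : B.Complete)
    (a : Fin n) (m : Fin K) : 1 + B.odds a m = 1 / B.lam m a := by
  have hl := (lam_pos hpos hind hcomp a m).ne'
  rw [odds]
  field_simp
  ring

theorem lamMin_pos (hpos : B.Positivity) (hind : B.IndepGivenMediator) (hcomp : B.Complete)
    (a : Fin n) : 0 < B.lamMin a := by
  have := B.nonempty_mediator a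
  obtain ⟨m, hm⟩ := exists_eq_ciInf_of_finite (f := fun m => B.lam m a)
  rw [lamMin, ← hm]
  exact lam_pos hpos hind hcomp a m

theorem lamMin_le (a : Fin n) (m : Fin K) : B.lamMin a ≤ B.lam m a :=
  ciInf_le (Set.finite_range _).bddBelow m

theorem one_div_lam_le (hpos : B.Positivity) (hind : B.IndepGivenMediator) (hcomp : B.Complete)
    (a : Fin n) (m : Fin K) : 1 / B.lam m a ≤ 1 / B.lamMin a :=
  one_div_le_one_div_of_le (lamMin_pos hpos hind hcomp a) (lamMin_le a m)

theorem iSup_one_add_odds (hpos : B.Positivity) (hind : B.IndepGivenMediator)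
    (hcomp : B.Complete) (a : Fin n) : ⨆ m, (1 + B.odds a m) = 1 / B.lamMin a := by
  have := B.nonempty_mediator a
  simp only [one_div_lam_eq hpos hind hcomp]
  refine le_antisymm (ciSup_le fun m => one_div_lam_le hpos hind hcomp a m) ?_
  obtain ⟨m, hm⟩ := exists_eq_ciInf_of_finite (f := fun m => B.lam m a)
  rw [lamMin, ← hm]
  exact le_ciSup (f := fun m => 1 / B.lam m a) (Set.finite_range _).bddAbove m

/-! ### The pseudo-inverse of the true matrix -/

theorem det_gram_Theta_ne_zero (hpos : B.Positivity) (hcomp : B.Complete) (a : Fin n) :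
    ((B.Theta a)ᵀᵀ * (B.Theta a)ᵀ).det ≠ 0 := by
  refine det_gram_ne_zero fun g hg => ?_
  funext m
  refine hcomp a g (fun j => ?_) m (hpos a m).1
  simpa [Matrix.mulVec, dotProduct] using congrFun hg j

theorem Theta_mul_pinv (hpos : B.Positivity) (hcomp : B.Complete) (a : Fin n) :
    B.Theta a * pinv (B.Theta a) = 1 := by
  have h := pinv_mul_self_of_det_ne_zero (det_gram_Theta_ne_zero hpos hcomp a)
  rw [pinv_transpose, ← Matrix.transpose_mul] at h
  simpa using congrArg Matrix.transpose h

theorem Theta_nonneg (a : Fin n) (m : Fin K) (j : Fin L) : 0 ≤ B.Theta a m j := B.law_nonneg a _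

theorem sum_Theta (hpos : B.Positivity) (hind : B.IndepGivenMediator) (a : Fin n) (m : Fin K) :
    ∑ j, B.Theta a m j = B.p m a * B.lam m a * B.gam m a := by
  simp only [Theta_eq hpos hind, ← Finset.mul_sum, sum_cond hpos, mul_one]

/-- Since `Θ Θ† = 1`, the norm of `Θ†` is at least the inverse of every row sum of `Θ`. Through this
bound the noise of the second step is dominated by the confidence width of the first. -/
theorem one_le_mul_infNorm_pinv (hpos : B.Positivity) (hind : B.IndepGivenMediator)
    (hcomp : B.Complete) (a : Fin n) (m : Fin K) :
    1 ≤ B.p m a * B.lam m a * B.gam m a * infNorm (pinv (B.Theta a)) := by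
  have h : (B.Theta a * pinv (B.Theta a)) m m = 1 := by
    rw [Theta_mul_pinv hpos hcomp, Matrix.one_apply_eq]
  rw [← h, Matrix.mul_apply, ← sum_Theta hpos hind, Finset.sum_mul]
  refine Finset.sum_le_sum fun j _ => mul_le_mul_of_nonneg_left ?_ (Theta_nonneg a m j)
  calc pinv (B.Theta a) j m ≤ |pinv (B.Theta a) j m| := le_abs_self _
    _ ≤ ∑ m', |pinv (B.Theta a) j m'| :=
      Finset.single_le_sum (f := fun m' => |pinv (B.Theta a) j m'|)
        (fun _ _ => abs_nonneg _) (Finset.mem_univ m)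
    _ ≤ _ := sum_abs_row_le_infNorm _ j

theorem infNorm_Theta_pos (hpos : B.Positivity) (hind : B.IndepGivenMediator)
    (hcomp : B.Complete) (a : Fin n) : 0 < infNorm (B.Theta a) := by
  obtain ⟨m⟩ := B.nonempty_mediator a
  have hrow := sum_abs_row_le_infNorm (B.Theta a) m
  simp only [abs_of_nonneg (Theta_nonneg a m _), sum_Theta hpos hind] at hrow
  have := mul_pos (mul_pos (hpos a m).1 (lam_pos hpos hind hcomp a m)) (hpos a m).2
  linarith

theorem infNorm_pinv_le {C : Fin n → ℝ} (hpos : B.Positivity) (hind : B.IndepGivenMediator)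
    (hcomp : B.Complete) (hC : ∀ a, condNumber (B.Theta a) ≤ C a) (a : Fin n) :
    infNorm (pinv (B.Theta a)) ≤ C a / infNorm (B.Theta a) := by
  rw [le_div_iff₀ (infNorm_Theta_pos hpos hind hcomp a), mul_comm]
  exact hC a

theorem one_div_lam_gam_le (hpos : B.Positivity) (hind : B.IndepGivenMediator)
    (hcomp : B.Complete) (a : Fin n) (m : Fin K) :
    1 / (B.lam m a * B.gam m a) ≤ infNorm (pinv (B.Theta a)) := by
  have hlg := mul_pos (lam_pos hpos hind hcomp a m) (hpos a m).2
  rw [div_le_iff₀ hlg]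
  refine (one_le_mul_infNorm_pinv hpos hind hcomp a m).trans ?_
  have h := mul_le_mul_of_nonneg_right (p_le_one hpos a m)
    (mul_nonneg hlg.le (infNorm_nonneg (pinv (B.Theta a))))
  linarith

theorem one_le_infNorm_pinv (hpos : B.Positivity) (hind : B.IndepGivenMediator)
    (hcomp : B.Complete) (a : Fin n) : 1 ≤ infNorm (pinv (B.Theta a)) := by
  obtain ⟨m⟩ := B.nonempty_mediator a
  refine le_trans ?_ (one_div_lam_gam_le hpos hind hcomp a m)
  rw [le_div_iff₀ (mul_pos (lam_pos hpos hind hcomp a m) (hpos a m).2), one_mul]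
  exact mul_le_one₀ (lam_le_one hpos a m) (hpos a m).2.le (gam_le_one hpos a m)

theorem one_le_one_div_lamMin (hpos : B.Positivity) (hind : B.IndepGivenMediator)
    (hcomp : B.Complete) (a : Fin n) : 1 ≤ 1 / B.lamMin a := by
  obtain ⟨m⟩ := B.nonempty_mediator a
  rw [le_div_iff₀ (lamMin_pos hpos hind hcomp a), one_mul]
  exact (lamMin_le a m).trans (lam_le_one hpos a m)

end Bandit

/-! ### The estimators as functions of observation frequencies -/

section Plugin

variable {K L : ℕ}

/-- The matrix `[v(M = m, Y = y)]` of the frequencies with both variables observed. -/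
def thetaOf (v : Obs K L → ℝ) : Matrix (Fin K) (Fin L) ℝ := fun m j => v (some m, some j)

/-- The frequencies `[v(Y = y, mediator missing)]`. -/
def missOf (v : Obs K L → ℝ) : Fin L → ℝ := fun j => v (none, some j)

/-- The least squares solution of `∑_m v(m, y) x(m) = v(?, y)`. -/
noncomputable def oddsOf (v : Obs K L → ℝ) : Fin K → ℝ := pinv (thetaOf v)ᵀ *ᵥ missOf v

/-- The frequency of an observed mediator value. -/
def seenOf (v : Obs K L → ℝ) (m : Fin K) : ℝ := ∑ o, v (some m, o)

/-- The frequency of a mediator value observed together with an outcome. -/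
def bothOf (v : Obs K L → ℝ) (m : Fin K) : ℝ := ∑ j, v (some m, some j)

/-- The sum of the outcomes observed together with a mediator value, weighted by frequency. -/
def rewardOf (y : Fin L → ℝ) (v : Obs K L → ℝ) (m : Fin K) : ℝ := ∑ j, v (some m, some j) * y j

/-- The estimate of `ℙ(M = m)`. -/
noncomputable def pOf (v : Obs K L → ℝ) (m : Fin K) : ℝ := (1 + oddsOf v m) * seenOf v m

/-- The two-step estimate of the mean outcome. -/
noncomputable def meanOf (y : Fin L → ℝ) (v : Obs K L → ℝ) : ℝ :=
  ∑ m, pOf v m * (rewardOf y v m / bothOf v m)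

theorem continuous_thetaOf : Continuous (thetaOf : (Obs K L → ℝ) → _) :=
  continuous_matrix fun _ _ => continuous_apply _

theorem continuous_seenOf (m : Fin K) : Continuous fun v : Obs K L → ℝ => seenOf v m := by
  unfold seenOf; fun_prop

theorem continuous_bothOf (m : Fin K) : Continuous fun v : Obs K L → ℝ => bothOf v m := by
  unfold bothOf; fun_prop

theorem continuous_rewardOf (y : Fin L → ℝ) (m : Fin K) :
    Continuous fun v : Obs K L → ℝ => rewardOf y v m := by
  unfold rewardOf; fun_prop

end Plugin

namespace Bandit

variable {n K L : ℕ} (B : Bandit n K L)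

/-- The weight of the `j`-th residual of the equations `Θᵀ x = b` in the first-order expansion of
the estimated mean. -/
noncomputable def residualWeight (a : Fin n) (j : Fin L) : ℝ :=
  ∑ m, pinv (B.Theta a)ᵀ m j * (B.p m a * B.lam m a * B.condMean a m)

/-- The influence function of the two-step estimator, before centering: the estimated mean is, to
first order, the average of this function over the observations. -/
noncomputable def influence (a : Fin n) : Obs K L → ℝ
  | (none, none) => 0
  | (none, some j) => B.residualWeight a j
  | (some m, none) => (1 + B.odds a m) * B.condMean a m
  | (some m, some j) => -(B.odds a m * B.residualWeight a j) + (1 + B.odds a m) * B.condMean a m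
      + (1 + B.odds a m) / B.gam m a * (B.value j - B.condMean a m)

/-- The residual of the `j`-th equation `∑_m v(m, y_j) x(m) = v(?, y_j)` at the true inverse odds
ratios. -/
noncomputable def oddsResidual (a : Fin n) (v : Obs K L → ℝ) (j : Fin L) : ℝ :=
  missOf v j - ∑ m, thetaOf v m j * B.odds a m

/-- The sum, weighted by frequency, of `Y - 𝔼[Y | m, a]` over the observations with `M = m`. -/
noncomputable def rewardResidual (a : Fin n) (v : Obs K L → ℝ) (m : Fin K) : ℝ :=
  rewardOf B.value v m - B.condMean a m * bothOf v m

theorem sum_mul_influence (a : Fin n) (v : Obs K L → ℝ) :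
    ∑ o, v o * B.influence a o = ∑ j, B.oddsResidual a v j * B.residualWeight a j
      + ∑ m, (1 + B.odds a m) * B.condMean a m * seenOf v m
      + ∑ m, (1 + B.odds a m) / B.gam m a * B.rewardResidual a v m := by
  have h1 : ∀ m, v (some m, none) * B.influence a (some m, none)
      + ∑ j, v (some m, some j) * B.influence a (some m, some j)
      = -(∑ j, thetaOf v m j * B.odds a m * B.residualWeight a j)
        + (1 + B.odds a m) * B.condMean a m * seenOf v m
        + (1 + B.odds a m) / B.gam m a * B.rewardResidual a v m := by
    intro m
    simp only [seenOf, Fintype.sum_option, rewardResidual, rewardOf, bothOf, mul_add, mul_sub,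
      Finset.mul_sum, influence, Finset.sum_add_distrib, thetaOf, ← Finset.sum_neg_distrib]
    have : ∑ j, v (some m, some j) * ((1 + B.odds a m) / B.gam m a * B.value j)
        = ∑ j, (1 + B.odds a m) / B.gam m a * (v (some m, some j) * B.value j) :=
      Finset.sum_congr rfl fun j _ => by ring
    simp only [Finset.sum_sub_distrib, this, ← Finset.sum_mul, ← Finset.mul_sum]
    have h2 : ∑ j, v (some m, some j) * -(B.odds a m * B.residualWeight a j)
        = ∑ j, -(v (some m, some j) * B.odds a m * B.residualWeight a j) :=
      Finset.sum_congr rfl fun j _ => by ring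
    rw [h2]
    ring
  simp only [Fintype.sum_prod_type, Fintype.sum_option, h1]
  simp only [Finset.sum_add_distrib, oddsResidual, sub_mul, Finset.sum_mul,
    Finset.sum_sub_distrib, Finset.sum_neg_distrib, influence, missOf]
  rw [Finset.sum_comm (f := fun j m => thetaOf v m j * B.odds a m * B.residualWeight a j)]
  ring

variable {B}

theorem thetaOf_obsProb (a : Fin n) : thetaOf (B.obsProb a) = B.Theta a := by
  ext m j
  exact B.obsProb_some_some a m j

theorem bothOf_obsProb (hpos : B.Positivity) (hind : B.IndepGivenMediator) (a : Fin n)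
    (m : Fin K) : bothOf (B.obsProb a) m = B.p m a * B.lam m a * B.gam m a := by
  simp only [bothOf, obsProb_some_some, sum_Theta hpos hind]

theorem rewardOf_obsProb (hpos : B.Positivity) (hind : B.IndepGivenMediator) (a : Fin n)
    (m : Fin K) : rewardOf B.value (B.obsProb a) m
      = B.p m a * B.lam m a * B.gam m a * B.condMean a m := by
  simp only [rewardOf, obsProb_some_some, Theta_eq hpos hind, condMean, Finset.mul_sum, mul_assoc]

theorem oddsResidual_obsProb (hpos : B.Positivity) (hind : B.IndepGivenMediator)
    (hcomp : B.Complete) (a : Fin n) (j : Fin L) : B.oddsResidual a (B.obsProb a) j = 0 := by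
  rw [oddsResidual, thetaOf_obsProb, sum_Theta_mul_odds hpos hind hcomp, missOf, sub_self]

theorem rewardResidual_obsProb (hpos : B.Positivity) (hind : B.IndepGivenMediator) (a : Fin n)
    (m : Fin K) : B.rewardResidual a (B.obsProb a) m = 0 := by
  rw [rewardResidual, rewardOf_obsProb hpos hind, bothOf_obsProb hpos hind]
  ring

theorem sum_obsProb_mul_influence (hpos : B.Positivity) (hind : B.IndepGivenMediator)
    (hcomp : B.Complete) (a : Fin n) : ∑ o, B.obsProb a o * B.influence a o = B.mean a := by
  rw [sum_mul_influence, mean_eq hpos hind]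
  simp only [oddsResidual_obsProb hpos hind hcomp, rewardResidual_obsProb hpos hind, zero_mul,
    mul_zero, Finset.sum_const_zero, zero_add, add_zero]
  refine Finset.sum_congr rfl fun m _ => ?_
  have hl := (lam_pos hpos hind hcomp a m).ne'
  rw [one_div_lam_eq hpos hind hcomp, seenOf, sum_obsProb_some_eq hpos hind]
  field_simp

theorem abs_residualWeight_le (hval : ∀ j, |B.value j| ≤ 1) (hpos : B.Positivity)
    (hind : B.IndepGivenMediator) (hcomp : B.Complete) (a : Fin n) (j : Fin L) :
    |B.residualWeight a j| ≤ infNorm (pinv (B.Theta a)) := by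
  refine le_trans ?_ (sum_abs_row_le_infNorm (pinv (B.Theta a)) j)
  refine (Finset.abs_sum_le_sum_abs _ _).trans (Finset.sum_le_sum fun m _ => ?_)
  rw [pinv_transpose, Matrix.transpose_apply, abs_mul]
  refine mul_le_of_le_one_right (abs_nonneg _) ?_
  rw [abs_mul, abs_of_pos (mul_pos (hpos a m).1 (lam_pos hpos hind hcomp a m))]
  exact mul_le_one₀
    (mul_le_one₀ (p_le_one hpos a m) (lam_pos hpos hind hcomp a m).le (lam_le_one hpos a m))
    (abs_nonneg _) (abs_condMean_le_one hval hpos a m)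

/-- The range of the centered influence function. -/
theorem abs_influence_sub_mean_le (hval : ∀ j, |B.value j| ≤ 1) (hpos : B.Positivity)
    (hind : B.IndepGivenMediator) (hcomp : B.Complete) (a : Fin n) (o : Obs K L) :
    |B.influence a o - B.mean a| ≤ 4 * infNorm (pinv (B.Theta a)) * (1 / B.lamMin a) := by
  set D := infNorm (pinv (B.Theta a))
  set l := 1 / B.lamMin a
  have hD : 1 ≤ D := one_le_infNorm_pinv hpos hind hcomp a
  have hl : 1 ≤ l := one_le_one_div_lamMin hpos hind hcomp a
  have hDl : 0 ≤ (D - 1) * (l - 1) := mul_nonneg (by linarith) (by linarith)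
  have hmean := abs_le.1 (abs_mean_le_one hval a)
  have hw := fun j => abs_residualWeight_le hval hpos hind hcomp a j
  have hlm := fun m => one_div_lam_le hpos hind hcomp a m
  have hlm1 : ∀ m, 1 ≤ 1 / B.lam m a := fun m => by
    rw [le_div_iff₀ (lam_pos hpos hind hcomp a m), one_mul]; exact lam_le_one hpos a m
  have hodds : ∀ m, 0 ≤ B.odds a m ∧ 1 + B.odds a m ≤ l := fun m => by
    have := one_div_lam_eq hpos hind hcomp a m
    constructor <;> linarith [hlm m, hlm1 m]
  have hcm : ∀ m, |(1 + B.odds a m) * B.condMean a m| ≤ l := fun m => by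
    rw [abs_mul, abs_of_nonneg (by linarith [(hodds m).1])]
    exact (mul_le_of_le_one_right (by linarith [(hodds m).1])
      (abs_condMean_le_one hval hpos a m)).trans (hodds m).2
  obtain ⟨_ | m, _ | j⟩ := o
  · rw [influence, abs_le]
    constructor <;> nlinarith
  · have := abs_le.1 (hw j)
    rw [influence, abs_le]
    constructor <;> nlinarith
  · have := abs_le.1 (hcm m)
    rw [influence, abs_le]
    constructor <;> nlinarith
  · have h1 : |B.odds a m * B.residualWeight a j| ≤ (l - 1) * D := by
      rw [abs_mul, abs_of_nonneg (hodds m).1]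
      exact mul_le_mul (by linarith [(hodds m).2]) (hw j) (abs_nonneg _) (by linarith)
    have h2 : |(1 + B.odds a m) / B.gam m a * (B.value j - B.condMean a m)| ≤ D * 2 := by
      rw [one_div_lam_eq hpos hind hcomp, div_div, abs_mul]
      have hg := mul_pos (lam_pos hpos hind hcomp a m) (hpos a m).2
      rw [abs_of_nonneg (one_div_pos.2 hg).le]
      refine mul_le_mul (one_div_lam_gam_le hpos hind hcomp a m) ?_ (abs_nonneg _) (by linarith)
      have := abs_le.1 (hval j)
      have := abs_le.1 (abs_condMean_le_one hval hpos a m)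
      rw [abs_le]; constructor <;> linarith
    have h1 := abs_le.1 h1
    have h2 := abs_le.1 h2
    have := abs_le.1 (hcm m)
    rw [influence, abs_le]
    constructor <;> nlinarith

/-! ### Behaviour of the estimators near the true frequencies -/

theorem continuousAt_pinv_thetaOf (hpos : B.Positivity) (hcomp : B.Complete) (a : Fin n) :
    ContinuousAt (fun v : Obs K L → ℝ => pinv (thetaOf v)ᵀ) (B.obsProb a) := by
  have h := det_gram_Theta_ne_zero hpos hcomp a
  rw [← thetaOf_obsProb] at h
  exact (continuousAt_pinv h).comp (f := fun v => (thetaOf v)ᵀ)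
    continuous_thetaOf.matrix_transpose.continuousAt

theorem eventually_pinv_mul_thetaOf (hpos : B.Positivity) (hcomp : B.Complete) (a : Fin n) :
    ∀ᶠ v in 𝓝 (B.obsProb a), pinv (thetaOf v)ᵀ * (thetaOf v)ᵀ = 1 := by
  have h := det_gram_Theta_ne_zero hpos hcomp a
  rw [← thetaOf_obsProb] at h
  have hc : Continuous fun v : Obs K L → ℝ => ((thetaOf v)ᵀᵀ * (thetaOf v)ᵀ).det :=
    (continuous_thetaOf.matrix_transpose.matrix_transpose.matrix_mul
      continuous_thetaOf.matrix_transpose).matrix_det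
  filter_upwards [hc.continuousAt.eventually_ne h] with v hv
  exact pinv_mul_self_of_det_ne_zero hv

theorem oddsOf_sub_odds {v : Obs K L → ℝ} (hv : pinv (thetaOf v)ᵀ * (thetaOf v)ᵀ = 1)
    (a : Fin n) (m : Fin K) :
    oddsOf v m = B.odds a m + ∑ j, pinv (thetaOf v)ᵀ m j * B.oddsResidual a v j := by
  have h1 : B.odds a = pinv (thetaOf v)ᵀ *ᵥ ((thetaOf v)ᵀ *ᵥ B.odds a) := by
    rw [Matrix.mulVec_mulVec, hv, Matrix.one_mulVec]
  have h2 : B.odds a m = ∑ j, pinv (thetaOf v)ᵀ m j * ∑ m', thetaOf v m' j * B.odds a m' :=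
    congrFun h1 m
  rw [h2]
  simp only [oddsOf, Matrix.mulVec, dotProduct, oddsResidual, mul_sub, Finset.sum_sub_distrib]
  ring

theorem continuousAt_oddsOf (hpos : B.Positivity) (hcomp : B.Complete) (a : Fin n)
    (m : Fin K) : ContinuousAt (fun v : Obs K L → ℝ => oddsOf v m) (B.obsProb a) := by
  have h := continuousAt_pinv_thetaOf hpos hcomp a
  simp only [oddsOf, Matrix.mulVec, dotProduct, missOf]
  refine tendsto_finsetSum _ fun j _ => ?_
  have h1 : ContinuousAt (fun v : Obs K L → ℝ => pinv (thetaOf v)ᵀ m j) (B.obsProb a) :=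
    (continuous_id.matrix_elem m j).continuousAt.comp h
  exact h1.mul (continuous_apply _).continuousAt

theorem oddsOf_obsProb (hpos : B.Positivity) (hind : B.IndepGivenMediator)
    (hcomp : B.Complete) (a : Fin n) (m : Fin K) : oddsOf (B.obsProb a) m = B.odds a m := by
  rw [oddsOf_sub_odds (B := B) (eventually_pinv_mul_thetaOf hpos hcomp a).self_of_nhds a m]
  simp [oddsResidual_obsProb hpos hind hcomp]

theorem seenOf_obsProb (hpos : B.Positivity) (hind : B.IndepGivenMediator) (a : Fin n)
    (m : Fin K) : seenOf (B.obsProb a) m = B.p m a * B.lam m a :=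
  sum_obsProb_some_eq hpos hind a m

theorem continuousAt_pOf (hpos : B.Positivity) (hcomp : B.Complete) (a : Fin n)
    (m : Fin K) : ContinuousAt (fun v : Obs K L → ℝ => pOf v m) (B.obsProb a) :=
  (continuousAt_const.add (continuousAt_oddsOf hpos hcomp a m)).mul
    (continuous_seenOf m).continuousAt

theorem pOf_obsProb (hpos : B.Positivity) (hind : B.IndepGivenMediator)
    (hcomp : B.Complete) (a : Fin n) (m : Fin K) : pOf (B.obsProb a) m = B.p m a := by
  have hl := (lam_pos hpos hind hcomp a m).ne'
  rw [pOf, oddsOf_obsProb hpos hind hcomp, seenOf_obsProb hpos hind,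
    one_div_lam_eq hpos hind hcomp]
  field_simp

/-- The error of the linearization of the estimated mean, as a sum of products of two factors that
both vanish at the true frequencies, one of them linear. -/
theorem meanOf_sub_sum_influence {v : Obs K L → ℝ} {a : Fin n}
    (hv : pinv (thetaOf v)ᵀ * (thetaOf v)ᵀ = 1) (hb : ∀ m, bothOf v m ≠ 0) :
    meanOf B.value v - ∑ o, v o * B.influence a o
      = ∑ j, B.oddsResidual a v j * (∑ m, pinv (thetaOf v)ᵀ m j *
            (seenOf v m * (rewardOf B.value v m / bothOf v m)) - B.residualWeight a j)
        + ∑ m, B.rewardResidual a v m *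
          ((1 + B.odds a m) * (seenOf v m / bothOf v m - 1 / B.gam m a)) := by
  have h1 : meanOf B.value v
      = ∑ m, ∑ j, B.oddsResidual a v j * (pinv (thetaOf v)ᵀ m j *
          (seenOf v m * (rewardOf B.value v m / bothOf v m)))
        + ∑ m, (1 + B.odds a m) * B.condMean a m * seenOf v m
        + ∑ m, B.rewardResidual a v m * ((1 + B.odds a m) * (seenOf v m / bothOf v m)) := by
    rw [meanOf, ← Finset.sum_add_distrib, ← Finset.sum_add_distrib]
    refine Finset.sum_congr rfl fun m _ => ?_
    have hs : ∑ j, B.oddsResidual a v j * (pinv (thetaOf v)ᵀ m j *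
          (seenOf v m * (rewardOf B.value v m / bothOf v m)))
        = (∑ j, pinv (thetaOf v)ᵀ m j * B.oddsResidual a v j) *
          (seenOf v m * (rewardOf B.value v m / bothOf v m)) := by
      rw [Finset.sum_mul]
      exact Finset.sum_congr rfl fun j _ => by ring
    have hbm := hb m
    rw [hs, pOf, oddsOf_sub_odds (B := B) hv a m, rewardResidual]
    field_simp
    ring
  rw [h1, sum_mul_influence, Finset.sum_comm]
  simp only [mul_sub, Finset.sum_sub_distrib, Finset.mul_sum]
  have h2 : ∑ m, (1 + B.odds a m) / B.gam m a * B.rewardResidual a v m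
      = ∑ m, B.rewardResidual a v m * ((1 + B.odds a m) * (1 / B.gam m a)) :=
    Finset.sum_congr rfl fun m _ => by ring
  rw [h2]
  ring

theorem isBigO_oddsResidual (hpos : B.Positivity) (hind : B.IndepGivenMediator)
    (hcomp : B.Complete) (a : Fin n) (j : Fin L) :
    (fun v => B.oddsResidual a v j) =O[𝓝 (B.obsProb a)] fun v => v - B.obsProb a := by
  have hd : Differentiable ℝ fun v : Obs K L → ℝ => B.oddsResidual a v j := by
    unfold oddsResidual missOf thetaOf; fun_prop
  simpa [oddsResidual_obsProb hpos hind hcomp] using (hd (B.obsProb a)).isBigO_sub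

theorem isBigO_rewardResidual (hpos : B.Positivity) (hind : B.IndepGivenMediator)
    (a : Fin n) (m : Fin K) :
    (fun v => B.rewardResidual a v m) =O[𝓝 (B.obsProb a)] fun v => v - B.obsProb a := by
  have hd : Differentiable ℝ fun v : Obs K L → ℝ => B.rewardResidual a v m := by
    unfold rewardResidual rewardOf bothOf; fun_prop
  simpa [rewardResidual_obsProb hpos hind] using (hd (B.obsProb a)).isBigO_sub

theorem bothOf_obsProb_ne_zero (hpos : B.Positivity) (hind : B.IndepGivenMediator)
    (hcomp : B.Complete) (a : Fin n) (m : Fin K) : bothOf (B.obsProb a) m ≠ 0 := by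
  rw [bothOf_obsProb hpos hind]
  exact (mul_pos (mul_pos (hpos a m).1 (lam_pos hpos hind hcomp a m)) (hpos a m).2).ne'

/-- The influence function is the derivative of the estimated mean at the true frequencies. -/
theorem isLittleO_meanOf_sub (hpos : B.Positivity) (hind : B.IndepGivenMediator)
    (hcomp : B.Complete) (a : Fin n) :
    (fun v => meanOf B.value v - ∑ o, v o * B.influence a o)
      =o[𝓝 (B.obsProb a)] fun v => v - B.obsProb a := by
  have hne := bothOf_obsProb_ne_zero hpos hind hcomp a
  have hb : ∀ᶠ v in 𝓝 (B.obsProb a), ∀ m, bothOf v m ≠ 0 :=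
    eventually_all.2 fun m => (continuous_bothOf m).continuousAt.eventually_ne (hne m)
  have hratio : ∀ m, ContinuousAt (fun v => rewardOf B.value v m / bothOf v m) (B.obsProb a) :=
    fun m => (continuous_rewardOf B.value m).continuousAt.div
      (continuous_bothOf m).continuousAt (hne m)
  have hpinv : ∀ m j, ContinuousAt (fun v : Obs K L → ℝ => pinv (thetaOf v)ᵀ m j)
      (B.obsProb a) := fun m j =>
    (continuous_id.matrix_elem m j).continuousAt.comp (continuousAt_pinv_thetaOf hpos hcomp a)
  have h1 : ∀ j, Tendsto (fun v => ∑ m, pinv (thetaOf v)ᵀ m j *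
      (seenOf v m * (rewardOf B.value v m / bothOf v m)) - B.residualWeight a j)
      (𝓝 (B.obsProb a)) (𝓝 0) := by
    intro j
    have hc : ContinuousAt (fun v => ∑ m, pinv (thetaOf v)ᵀ m j *
        (seenOf v m * (rewardOf B.value v m / bothOf v m)) - B.residualWeight a j)
        (B.obsProb a) := by
      refine ContinuousAt.sub (tendsto_finsetSum _ fun m _ => ?_) continuousAt_const
      exact (hpinv m j).mul ((continuous_seenOf m).continuousAt.mul (hratio m))
    have hz : ∑ m, pinv (thetaOf (B.obsProb a))ᵀ m j * (seenOf (B.obsProb a) m *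
        (rewardOf B.value (B.obsProb a) m / bothOf (B.obsProb a) m)) - B.residualWeight a j
        = 0 := by
      rw [sub_eq_zero, residualWeight]
      refine Finset.sum_congr rfl fun m _ => ?_
      have h := hne m
      rw [bothOf_obsProb hpos hind] at h
      rw [thetaOf_obsProb, seenOf_obsProb hpos hind, rewardOf_obsProb hpos hind,
        bothOf_obsProb hpos hind, mul_div_cancel_left₀ _ h]
    rw [← hz]
    exact hc
  have h2 : ∀ m, Tendsto (fun v => (1 + B.odds a m) * (seenOf v m / bothOf v m - 1 / B.gam m a))
      (𝓝 (B.obsProb a)) (𝓝 0) := by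
    intro m
    have hc : ContinuousAt (fun v => (1 + B.odds a m) *
        (seenOf v m / bothOf v m - 1 / B.gam m a)) (B.obsProb a) :=
      continuousAt_const.mul (((continuous_seenOf m).continuousAt.div
        (continuous_bothOf m).continuousAt (hne m)).sub continuousAt_const)
    have hz : (1 + B.odds a m) *
        (seenOf (B.obsProb a) m / bothOf (B.obsProb a) m - 1 / B.gam m a) = 0 := by
      have hp := (hpos a m).1.ne'
      have hl := (lam_pos hpos hind hcomp a m).ne'
      have hg := (hpos a m).2.ne'
      rw [seenOf_obsProb hpos hind, bothOf_obsProb hpos hind]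
      field_simp
      simp
    rw [← hz]
    exact hc
  have hmain : (fun v => ∑ j, B.oddsResidual a v j * (∑ m, pinv (thetaOf v)ᵀ m j *
            (seenOf v m * (rewardOf B.value v m / bothOf v m)) - B.residualWeight a j)
        + ∑ m, B.rewardResidual a v m *
          ((1 + B.odds a m) * (seenOf v m / bothOf v m - 1 / B.gam m a)))
      =o[𝓝 (B.obsProb a)] fun v => v - B.obsProb a := by
    rw [← isLittleO_norm_right]
    refine IsLittleO.add (IsLittleO.fun_sum fun j _ => ?_) (IsLittleO.fun_sum fun m _ => ?_)
    · simpa using (isBigO_oddsResidual hpos hind hcomp a j).norm_right.mul_isLittleO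
        ((isLittleO_one_iff ℝ).2 (h1 j))
    · simpa using (isBigO_rewardResidual hpos hind a m).norm_right.mul_isLittleO
        ((isLittleO_one_iff ℝ).2 (h2 m))
  refine hmain.congr' ?_ EventuallyEq.rfl
  filter_upwards [hb, eventually_pinv_mul_thetaOf hpos hcomp a] with v hv1 hv2
  exact (meanOf_sub_sum_influence hv2 hv1).symm

end Bandit

/-! ### The confidence width near the true frequencies -/

section Plugin

variable {K L : ℕ}

/-- The estimate of `min_m ℙ(O^M = 1 | m)`. -/
noncomputable def lamOf (v : Obs K L → ℝ) : ℝ := 1 / ⨆ m, (1 + oddsOf v m)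

/-- The factor of `2√(α log T / (2 T_a))` in the upper confidence bound. -/
noncomputable def widthOf (c : ℝ) (v : Obs K L → ℝ) : ℝ :=
  8 * (c / infNorm (thetaOf v)) * (K / lamOf v) + 1 / lamOf v

/-- The variance factor in the second exploration bonus. -/
noncomputable def varOf (v : Obs K L → ℝ) : ℝ := ∑ m, 4 * pOf v m ^ 2 / bothOf v m

end Plugin

namespace Bandit

variable {n K L : ℕ} (B : Bandit n K L)

/-- The value of `widthOf` at the true frequencies. -/
noncomputable def width (C : Fin n → ℝ) (a : Fin n) : ℝ :=
  8 * (C a / infNorm (B.Theta a)) * (K / B.lamMin a) + 1 / B.lamMin a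

variable {B} {C : Fin n → ℝ}

/-- The width is at least twice the range of the centered influence function. -/
theorem mul_le_width (hpos : B.Positivity) (hind : B.IndepGivenMediator) (hcomp : B.Complete)
    (hC : ∀ a, condNumber (B.Theta a) ≤ C a) (a : Fin n) :
    8 * infNorm (pinv (B.Theta a)) * (1 / B.lamMin a) ≤ B.width C a := by
  have hl := lamMin_pos hpos hind hcomp a
  have hD := infNorm_pinv_le hpos hind hcomp hC a
  have hK : (1 : ℝ) ≤ K := by
    have := Fin.pos_iff_nonempty.2 (B.nonempty_mediator a)
    exact_mod_cast this
  have h1 : 8 * infNorm (pinv (B.Theta a)) * (1 / B.lamMin a)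
      ≤ 8 * (C a / infNorm (B.Theta a)) * (K / B.lamMin a) :=
    mul_le_mul (by linarith) (div_le_div_of_nonneg_right hK hl.le) (one_div_pos.2 hl).le
      (by linarith [infNorm_nonneg (pinv (B.Theta a))])
  have := one_div_pos.2 hl
  rw [width]
  linarith

theorem eight_le_width (hpos : B.Positivity) (hind : B.IndepGivenMediator) (hcomp : B.Complete)
    (hC : ∀ a, condNumber (B.Theta a) ≤ C a) (a : Fin n) : 8 ≤ B.width C a := by
  refine le_trans ?_ (mul_le_width hpos hind hcomp hC a)
  nlinarith [one_le_infNorm_pinv hpos hind hcomp a, one_le_one_div_lamMin hpos hind hcomp a]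

theorem two_mul_width_le_S (hpos : B.Positivity) (hind : B.IndepGivenMediator)
    (hcomp : B.Complete) (hC : ∀ a, condNumber (B.Theta a) ≤ C a) (a : Fin n) :
    2 * B.width C a ≤ B.S C a := by
  refine le_trans ?_ (le_max_left _ _)
  have hl := lamMin_pos hpos hind hcomp a
  have hD := infNorm_pinv_le hpos hind hcomp hC a
  have h0 := infNorm_nonneg (pinv (B.Theta a))
  have : 0 ≤ C a / infNorm (B.Theta a) * (K / B.lamMin a) :=
    mul_nonneg (h0.trans hD) (by positivity)
  rw [width]
  have e : 2 / B.lamMin a = 2 * (1 / B.lamMin a) := by ring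
  rw [e]
  linarith

theorem continuousAt_lamOf (hpos : B.Positivity) (hind : B.IndepGivenMediator)
    (hcomp : B.Complete) (a : Fin n) :
    ContinuousAt (fun v : Obs K L → ℝ => lamOf v) (B.obsProb a) := by
  have := B.nonempty_mediator a
  refine continuousAt_const.div (continuousAt_iSup_of_finite fun m =>
    continuousAt_const.add (continuousAt_oddsOf hpos hcomp a m)) ?_
  simp only [oddsOf_obsProb hpos hind hcomp, iSup_one_add_odds hpos hind hcomp]
  exact (one_div_pos.2 (lamMin_pos hpos hind hcomp a)).ne'

theorem lamOf_obsProb (hpos : B.Positivity) (hind : B.IndepGivenMediator)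
    (hcomp : B.Complete) (a : Fin n) : lamOf (B.obsProb a) = B.lamMin a := by
  simp only [lamOf, oddsOf_obsProb hpos hind hcomp, iSup_one_add_odds hpos hind hcomp,
    one_div_one_div]

theorem continuousAt_widthOf (hpos : B.Positivity) (hind : B.IndepGivenMediator)
    (hcomp : B.Complete) (a : Fin n) (c : ℝ) :
    ContinuousAt (fun v : Obs K L → ℝ => widthOf c v) (B.obsProb a) := by
  have := B.nonempty_mediator a
  have hl : lamOf (B.obsProb a) ≠ 0 := by
    rw [lamOf_obsProb hpos hind hcomp]; exact (lamMin_pos hpos hind hcomp a).ne'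
  have hlam := continuousAt_lamOf hpos hind hcomp a
  have hnorm : Continuous fun v : Obs K L → ℝ => infNorm (thetaOf v) := by
    simp only [infNorm_eq_iSup]
    refine continuous_iff_continuousAt.2 fun v => continuousAt_iSup_of_finite fun i => ?_
    exact tendsto_finsetSum _ fun j _ => (continuous_apply (some i, some j)).continuousAt.abs
  have h0 : infNorm (thetaOf (B.obsProb a)) ≠ 0 := by
    rw [thetaOf_obsProb]; exact (infNorm_Theta_pos hpos hind hcomp a).ne'
  exact ((continuousAt_const.mul (continuousAt_const.div hnorm.continuousAt h0)).mul
    (continuousAt_const.div hlam hl)).add (continuousAt_const.div hlam hl)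

theorem widthOf_obsProb (hpos : B.Positivity) (hind : B.IndepGivenMediator)
    (hcomp : B.Complete) (a : Fin n) : widthOf (C a) (B.obsProb a) = B.width C a := by
  rw [widthOf, thetaOf_obsProb, lamOf_obsProb hpos hind hcomp, width]

theorem continuousAt_varOf (hpos : B.Positivity) (hind : B.IndepGivenMediator)
    (hcomp : B.Complete) (a : Fin n) :
    ContinuousAt (fun v : Obs K L → ℝ => varOf v) (B.obsProb a) :=
  tendsto_finsetSum _ fun m _ => (continuousAt_const.mul
    ((continuousAt_pOf hpos hcomp a m).pow 2)).div (continuous_bothOf m).continuousAt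
      (bothOf_obsProb_ne_zero hpos hind hcomp a m)

theorem varOf_obsProb (hpos : B.Positivity) (hind : B.IndepGivenMediator)
    (hcomp : B.Complete) (a : Fin n) :
    varOf (B.obsProb a) = 4 * ∑ m, B.p m a / (B.lam m a * B.gam m a) := by
  rw [varOf, Finset.mul_sum]
  refine Finset.sum_congr rfl fun m _ => ?_
  have hp := (hpos a m).1.ne'
  have hl := (lam_pos hpos hind hcomp a m).ne'
  have hg := (hpos a m).2.ne'
  rw [pOf_obsProb hpos hind hcomp, bothOf_obsProb hpos hind]
  field_simp

theorem sum_div_pos (hpos : B.Positivity) (hind : B.IndepGivenMediator) (hcomp : B.Complete)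
    (a : Fin n) : 0 < ∑ m, B.p m a / (B.lam m a * B.gam m a) := by
  have := B.nonempty_mediator a
  exact Finset.sum_pos (fun m _ => div_pos (hpos a m).1
    (mul_pos (lam_pos hpos hind hcomp a m) (hpos a m).2)) Finset.univ_nonempty

/-- The estimators at `v` are close enough to their true values for the confidence bound of the
arm `a` to be valid and of the right order. -/
def Close (B : Bandit n K L) (C : Fin n → ℝ) (a : Fin n) (v : Obs K L → ℝ) : Prop :=
  |meanOf B.value v - ∑ o, v o * B.influence a o| ≤ 1 / 2 * ‖v - B.obsProb a‖ ∧
    15 / 16 * B.width C a ≤ widthOf (C a) v ∧ widthOf (C a) v ≤ 2 * B.width C a ∧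
    varOf v ≤ 8 * ∑ m, B.p m a / (B.lam m a * B.gam m a)

/-- One radius works for all arms: near the true frequencies the estimators are close enough. -/
theorem exists_forall_close (hpos : B.Positivity) (hind : B.IndepGivenMediator)
    (hcomp : B.Complete) (hC : ∀ a, condNumber (B.Theta a) ≤ C a) :
    ∃ δ : ℝ, 0 < δ ∧ ∀ a v, ‖v - B.obsProb a‖ < δ → B.Close C a v := by
  have hev : ∀ a, ∀ᶠ v in 𝓝 (B.obsProb a), B.Close C a v := by
    intro a
    have hW := eight_le_width hpos hind hcomp hC a
    have hX := sum_div_pos hpos hind hcomp a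
    have hw := continuousAt_widthOf hpos hind hcomp a (C a)
    have hv := continuousAt_varOf hpos hind hcomp a
    have h1 := (isLittleO_meanOf_sub hpos hind hcomp a).def (c := 1 / 2) (by norm_num)
    have h2 : ∀ᶠ v in 𝓝 (B.obsProb a), 15 / 16 * B.width C a < widthOf (C a) v :=
      hw.eventually_const_lt (by beta_reduce; rw [widthOf_obsProb hpos hind hcomp]; linarith)
    have h3 : ∀ᶠ v in 𝓝 (B.obsProb a), widthOf (C a) v < 2 * B.width C a :=
      hw.eventually_lt_const (by beta_reduce; rw [widthOf_obsProb hpos hind hcomp]; linarith)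
    have h4 : ∀ᶠ v in 𝓝 (B.obsProb a),
        varOf v < 8 * ∑ m, B.p m a / (B.lam m a * B.gam m a) :=
      hv.eventually_lt_const (by beta_reduce; rw [varOf_obsProb hpos hind hcomp]; linarith)
    filter_upwards [h1, h2, h3, h4] with v h1 h2 h3 h4
    exact ⟨h1, h2.le, h3.le, h4.le⟩
  have hδ : ∀ a, ∃ δ : ℝ, 0 < δ ∧ ∀ v, ‖v - B.obsProb a‖ < δ → B.Close C a v := by
    intro a
    obtain ⟨δ, hδ, h⟩ := Metric.eventually_nhds_iff.1 (hev a)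
    exact ⟨δ, hδ, fun v hv => h (by rwa [dist_eq_norm])⟩
  choose δ hδ h using hδ
  have hmin : ∀ s : Finset (Fin n), ∃ ε : ℝ, 0 < ε ∧ ∀ a ∈ s, ε ≤ δ a := by
    intro s
    induction s using Finset.induction_on with
    | empty => exact ⟨1, one_pos, by simp⟩
    | insert a s _ ih =>
      obtain ⟨ε, hε, hs⟩ := ih
      refine ⟨min ε (δ a), lt_min hε (hδ a), fun b hb => ?_⟩
      rcases Finset.mem_insert.1 hb with rfl | hb
      · exact min_le_right _ _
      · exact (min_le_left _ _).trans (hs b hb)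
  obtain ⟨ε, hε, hs⟩ := hmin Finset.univ
  exact ⟨ε, hε, fun a v hv => h a v (hv.trans_le (hs a (Finset.mem_univ a)))⟩

end Bandit

/-! ### Empirical frequencies -/

section Empirical

variable {n K L : ℕ}

/-- The empirical frequencies of the observations among the pulls of `a`. -/
noncomputable def freq (h : History n K L) (a : Fin n) (o : Obs K L) : ℝ :=
  (h.count (a, o) : ℝ) / pulls h a

/-- The sum of `f` over the observations made when pulling `a`. -/
def armSum (f : Obs K L → ℝ) (h : History n K L) (a : Fin n) : ℝ :=
  (h.map fun e => if e.1 = a then f e.2 else 0).sum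

@[simp] theorem armSum_nil (f : Obs K L → ℝ) (a : Fin n) : armSum f [] a = 0 := rfl

theorem armSum_append (f : Obs K L → ℝ) (h : History n K L) (a b : Fin n) (o : Obs K L) :
    armSum f (h ++ [(b, o)]) a = armSum f h a + if b = a then f o else 0 := by
  simp [armSum]

theorem pulls_append (h : History n K L) (a b : Fin n) (o : Obs K L) :
    pulls (h ++ [(b, o)]) a = pulls h a + if b = a then 1 else 0 := by
  simp [pulls, List.countP_append, List.countP_singleton]

theorem sum_count_mul (f : Obs K L → ℝ) (h : History n K L) (a : Fin n) :
    ∑ o, (h.count (a, o) : ℝ) * f o = armSum f h a := by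
  induction h using List.reverseRecOn with
  | nil => simp
  | append_singleton h e ih =>
    obtain ⟨b, o'⟩ := e
    rw [armSum_append, ← ih]
    by_cases hb : b = a
    · subst hb
      simp [List.count_append, List.count_singleton, add_mul, Finset.sum_add_distrib]
    · simp [List.count_append, hb]

theorem armSum_const (c : ℝ) (h : History n K L) (a : Fin n) :
    armSum (fun _ => c) h a = pulls h a * c := by
  induction h using List.reverseRecOn with
  | nil => simp [pulls]
  | append_singleton h e ih =>
    obtain ⟨b, o'⟩ := e
    rw [armSum_append, pulls_append, ih]
    split_ifs <;> push_cast <;> ring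

theorem sum_freq_mul (f : Obs K L → ℝ) (h : History n K L) (a : Fin n) :
    ∑ o, freq h a o * f o = armSum f h a / pulls h a := by
  rw [← sum_count_mul, Finset.sum_div]
  exact Finset.sum_congr rfl fun o _ => by rw [freq]; ring

theorem sum_freq {h : History n K L} {a : Fin n} (hs : 0 < pulls h a) :
    ∑ o, freq h a o = 1 := by
  have := sum_freq_mul (fun _ => 1) h a
  rw [armSum_const] at this
  have hs' : (pulls h a : ℝ) ≠ 0 := by exact_mod_cast hs.ne'
  simpa [hs'] using this

theorem seenOf_freq (h : History n K L) (a : Fin n) (m : Fin K) :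
    seenOf (freq h a) m
      = (h.countP (fun e => e.1 = a ∧ e.2.1 = some m) : ℝ) / pulls h a := by
  simp only [seenOf, freq]
  rw [← Finset.sum_div]
  congr 1
  induction h using List.reverseRecOn with
  | nil => simp
  | append_singleton h e ih =>
    obtain ⟨b, o1, o2⟩ := e
    simp only [List.count_append, List.countP_append, Nat.cast_add, Finset.sum_add_distrib, ih]
    by_cases hb : b = a <;> by_cases ho : o1 = some m <;>
      simp [List.count_singleton, hb, ho]

theorem pullsObs_eq {h : History n K L} {a : Fin n} (hs : 0 < pulls h a) (m : Fin K) :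
    (pullsObs h a m : ℝ) = pulls h a * bothOf (freq h a) m := by
  have hs' : (pulls h a : ℝ) ≠ 0 := by exact_mod_cast hs.ne'
  simp only [pullsObs, bothOf, freq, Nat.cast_sum]
  rw [← Finset.sum_div, mul_div_cancel₀ _ hs']

theorem pHat_eq (h : History n K L) (a : Fin n) (m : Fin K) :
    pHat h a m = pOf (freq h a) m := by
  rw [pHat, pOf, seenOf_freq]
  rfl

theorem meanHat_eq {h : History n K L} {a : Fin n} (hs : 0 < pulls h a) (y : Fin L → ℝ) :
    meanHat h a y = meanOf y (freq h a) := by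
  have hs' : (pulls h a : ℝ) ≠ 0 := by exact_mod_cast hs.ne'
  rw [meanHat, meanOf]
  refine Finset.sum_congr rfl fun m _ => ?_
  have hr : rewardOf y (freq h a) m
      = (∑ j, (h.count (a, some m, some j) : ℝ) * y j) / pulls h a := by
    simp only [rewardOf, freq, Finset.sum_div]
    exact Finset.sum_congr rfl fun j _ => by ring
  rw [pHat_eq, condMeanHat, pullsObs_eq hs, hr, div_div]

/-- The upper confidence bound depends on the history through the number of pulls and the
empirical frequencies only. -/
theorem ucb_eq {h : History n K L} {a : Fin n} (hs : 0 < pulls h a) (y : Fin L → ℝ)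
    (C : Fin n → ℝ) (α : ℝ) (T : ℕ) :
    ucb h a y C α T = meanOf y (freq h a)
      + √(2 * α * Real.log T / pulls h a) * widthOf (C a) (freq h a)
      + √(α * Real.log T / 2 * (varOf (freq h a) / pulls h a)) := by
  have h1 : 2 * √(α * Real.log T / (2 * pulls h a)) = √(2 * α * Real.log T / pulls h a) := by
    rw [← Real.sqrt_sq (show (0 : ℝ) ≤ 2 by norm_num), ← Real.sqrt_mul (by norm_num),
      Real.sqrt_sq (by norm_num)]
    congr 1
    ring
  have h2 : ∑ m, 4 * pHat h a m ^ 2 / pullsObs h a m = varOf (freq h a) / pulls h a := by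
    rw [varOf, Finset.sum_div]
    refine Finset.sum_congr rfl fun m _ => ?_
    rw [pHat_eq, pullsObs_eq hs, div_div, mul_comm (pulls h a : ℝ)]
  rw [ucb, meanHat_eq hs, h1, h2]
  rfl

end Empirical

/-! ### Expectations along the interaction -/

section Expectation

variable {n K L : ℕ}

theorem play_concat (π : Policy n K L) (xs : List (Draw K L)) (d : Draw K L) :
    play π (xs ++ [d]) = play π xs ++ [(π (play π xs), observe d)] := by
  simp [play]

theorem length_play (π : Policy n K L) (xs : List (Draw K L)) :
    (play π xs).length = xs.length := by
  induction xs using List.reverseRecOn with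
  | nil => rfl
  | append_singleton xs d ih => simp [play_concat, ih]

theorem ofFn_snoc {α : Type*} {t : ℕ} (x : Fin t → α) (d : α) :
    List.ofFn (Fin.snoc (α := fun _ => α) x d) = List.ofFn x ++ [d] := by
  rw [List.ofFn_succ']
  simp [List.concat_eq_append]

theorem arm_snoc_castSucc (π : Policy n K L) {t : ℕ} (x : Fin t → Draw K L) (d : Draw K L)
    (i : Fin t) : arm π (Fin.snoc (α := fun _ => Draw K L) x d) i.castSucc = arm π x i := by
  rw [arm, arm, ofFn_snoc, List.take_append_of_le_length (by simp [i.2.le])]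
  rfl

theorem arm_snoc_last (π : Policy n K L) {t : ℕ} (x : Fin t → Draw K L) (d : Draw K L) :
    arm π (Fin.snoc (α := fun _ => Draw K L) x d) (Fin.last t) = π (play π (List.ofFn x)) := by
  rw [arm, ofFn_snoc, List.take_append_of_le_length (by simp), List.take_of_length_le (by simp)]

variable (B : Bandit n K L) (π : Policy n K L)

/-- Conditioning on the first `t` rounds. -/
theorem sum_trajProb_succ {t : ℕ} (F : (Fin (t + 1) → Draw K L) → ℝ) :
    ∑ x, trajProb B π x * F x = ∑ x : Fin t → Draw K L, trajProb B π x *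
      ∑ d, B.law (π (play π (List.ofFn x))) d * F (Fin.snoc (α := fun _ => Draw K L) x d) := by
  rw [← (Fin.snocEquiv fun _ => Draw K L).sum_comp, Fintype.sum_prod_type, Finset.sum_comm]
  refine Finset.sum_congr rfl fun x _ => ?_
  rw [Finset.mul_sum]
  refine Finset.sum_congr rfl fun d _ => ?_
  rw [← mul_assoc]
  congr 1
  change trajProb B π (Fin.snoc (α := fun _ => Draw K L) x d) = _
  simp only [trajProb, Fin.prod_univ_castSucc, arm_snoc_castSucc, arm_snoc_last,
    Fin.snoc_castSucc, Fin.snoc_last]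

/-- The expectation of a function of the history after `t` rounds. -/
noncomputable def trajE (t : ℕ) (g : History n K L → ℝ) : ℝ :=
  ∑ x : Fin t → Draw K L, trajProb B π x * g (play π (List.ofFn x))

theorem trajE_zero (g : History n K L → ℝ) : trajE B π 0 g = g [] := by
  simp [trajE, trajProb, play]

theorem trajE_succ (t : ℕ) (g : History n K L → ℝ) :
    trajE B π (t + 1) g
      = trajE B π t fun h => ∑ d, B.law (π h) d * g (h ++ [(π h, observe d)]) := by
  rw [trajE, sum_trajProb_succ B π fun x => g (play π (List.ofFn x))]
  simp only [trajE, ofFn_snoc, play_concat]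

theorem trajProb_nonneg {t : ℕ} (x : Fin t → Draw K L) : 0 ≤ trajProb B π x :=
  Finset.prod_nonneg fun _ _ => B.law_nonneg _ _

theorem trajE_const (t : ℕ) (c : ℝ) : trajE B π t (fun _ => c) = c := by
  induction t with
  | zero => rw [trajE_zero]
  | succ t ih => rw [trajE_succ]; simpa [← Finset.sum_mul, B.law_sum] using ih

theorem trajE_mono {t : ℕ} {g g' : History n K L → ℝ}
    (hg : ∀ xs : List (Draw K L), xs.length = t → g (play π xs) ≤ g' (play π xs)) :
    trajE B π t g ≤ trajE B π t g' :=
  Finset.sum_le_sum fun x _ =>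
    mul_le_mul_of_nonneg_left (hg _ (by simp)) (trajProb_nonneg B π x)

theorem trajE_add (t : ℕ) (g g' : History n K L → ℝ) :
    trajE B π t (fun h => g h + g' h) = trajE B π t g + trajE B π t g' := by
  simp only [trajE, mul_add, Finset.sum_add_distrib]

theorem trajE_const_mul (t : ℕ) (c : ℝ) (g : History n K L → ℝ) :
    trajE B π t (fun h => c * g h) = c * trajE B π t g := by
  simp only [trajE, Finset.mul_sum]
  exact Finset.sum_congr rfl fun x _ => by ring

theorem trajE_sum {ι : Type*} (s : Finset ι) (t : ℕ) (g : ι → History n K L → ℝ) :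
    trajE B π t (fun h => ∑ i ∈ s, g i h) = ∑ i ∈ s, trajE B π t (g i) := by
  simp only [trajE, Finset.mul_sum]
  exact Finset.sum_comm

theorem expectedRegret_eq_sum (T : ℕ) :
    expectedRegret B π T = ∑ t ∈ Finset.range T, trajE B π t fun h => B.gap (π h) := by
  induction T with
  | zero => simp [expectedRegret]
  | succ T ih =>
    rw [Finset.sum_range_succ, ← ih, expectedRegret,
      sum_trajProb_succ B π fun x => ∑ t, B.gap (arm π x t)]
    simp only [Fin.sum_univ_castSucc, arm_snoc_castSucc, arm_snoc_last, ← Finset.sum_mul,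
      B.law_sum, one_mul, mul_add, Finset.sum_add_distrib]
    rfl

end Expectation

/-! ### Concentration along the interaction -/

section Concentration

variable {n K L : ℕ} {B : Bandit n K L}

/-- Hoeffding's lemma for a random variable with finitely many values. -/
theorem sum_mul_exp_le {ι : Type*} [Fintype ι] {w f : ι → ℝ} (hw : ∀ i, 0 ≤ w i)
    (hw1 : ∑ i, w i = 1) (hf : ∑ i, w i * f i = 0) {b : ℝ} (hb : ∀ i, |f i| ≤ b) (θ : ℝ) :
    ∑ i, w i * Real.exp (θ * f i) ≤ Real.exp ((θ * b) ^ 2 / 2) := by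
  have hb0 : 0 ≤ b := by
    by_contra h
    have : IsEmpty ι := ⟨fun i => h ((abs_nonneg _).trans (hb i))⟩
    simp at hw1
  rcases hb0.eq_or_lt with rfl | hb0
  · have : ∀ i, f i = 0 := fun i => abs_nonpos_iff.1 (hb i)
    simp [this, hw1]
  refine le_trans ?_ (Real.cosh_le_exp_half_sq (θ * b))
  have hpt : ∀ i, Real.exp (θ * f i)
      ≤ Real.cosh (θ * b) + f i * (Real.sinh (θ * b) / b) := by
    intro i
    have hi := abs_le.1 (hb i)
    -- `θ f` is the convex combination of `θ b` and `-θ b` with weights `(1 ± f / b) / 2`.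
    have h := (convexOn_exp : ConvexOn ℝ Set.univ Real.exp).2 (Set.mem_univ (θ * b))
      (Set.mem_univ (-(θ * b)))
      (show 0 ≤ (1 + f i / b) / 2 by
        have : -1 ≤ f i / b := by rw [le_div_iff₀ hb0]; linarith
        linarith)
      (show 0 ≤ (1 - f i / b) / 2 by
        have : f i / b ≤ 1 := by rw [div_le_iff₀ hb0]; linarith
        linarith) (by ring)
    simp only [smul_eq_mul] at h
    have e : (1 + f i / b) / 2 * (θ * b) + (1 - f i / b) / 2 * -(θ * b) = θ * f i := by
      field_simp
      ring
    rw [e] at h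
    refine h.trans (le_of_eq ?_)
    rw [Real.cosh_eq, Real.sinh_eq]
    field_simp
    ring
  calc ∑ i, w i * Real.exp (θ * f i)
      ≤ ∑ i, w i * (Real.cosh (θ * b) + f i * (Real.sinh (θ * b) / b)) :=
        Finset.sum_le_sum fun i _ => mul_le_mul_of_nonneg_left (hpt i) (hw i)
    _ = Real.cosh (θ * b) := by
        simp only [mul_add, Finset.sum_add_distrib, ← mul_assoc, ← Finset.sum_mul, hw1, hf]
        ring

variable (π : Policy n K L)

/-- The exponential supermartingale of the sums of a bounded centered function over the pulls of
one arm. -/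
theorem trajE_exp_le_one {a : Fin n} {f : Obs K L → ℝ} (hf : ∑ o, B.obsProb a o * f o = 0)
    {b : ℝ} (hb : ∀ o, |f o| ≤ b) (θ : ℝ) (t : ℕ) :
    trajE B π t (fun h => Real.exp (θ * armSum f h a - pulls h a * ((θ * b) ^ 2 / 2))) ≤ 1 := by
  induction t with
  | zero => simp [trajE_zero, pulls]
  | succ t ih =>
    rw [trajE_succ]
    refine le_trans (trajE_mono B π fun xs _ => ?_) ih
    set h := play π xs
    simp only [armSum_append, pulls_append]
    by_cases ha : π h = a
    · simp only [ha, if_true]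
      have e : ∀ d : Draw K L, Real.exp (θ * (armSum f h a + f (observe d))
          - ((pulls h a + 1 : ℕ) : ℝ) * ((θ * b) ^ 2 / 2))
          = Real.exp (θ * armSum f h a - pulls h a * ((θ * b) ^ 2 / 2)) *
            Real.exp (-((θ * b) ^ 2 / 2)) * Real.exp (θ * f (observe d)) := by
        intro d
        rw [← Real.exp_add, ← Real.exp_add]
        congr 1
        push_cast
        ring
      have hH := sum_mul_exp_le (B.law_nonneg a) (B.law_sum a)
        (f := fun d => f (observe d)) (by rw [← B.sum_obsProb_mul, hf]) (fun d => hb _) θ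
      calc _ = Real.exp (θ * armSum f h a - pulls h a * ((θ * b) ^ 2 / 2)) *
            Real.exp (-((θ * b) ^ 2 / 2)) * ∑ d, B.law a d * Real.exp (θ * f (observe d)) := by
            rw [Finset.mul_sum]
            exact Finset.sum_congr rfl fun d _ => by rw [e]; ring
        _ ≤ Real.exp (θ * armSum f h a - pulls h a * ((θ * b) ^ 2 / 2)) *
            Real.exp (-((θ * b) ^ 2 / 2)) * Real.exp ((θ * b) ^ 2 / 2) := by gcongr
        _ = _ := by rw [mul_assoc, ← Real.exp_add, neg_add_cancel, Real.exp_zero, mul_one]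
    · simp only [ha, if_false, add_zero, ← Finset.sum_mul, B.law_sum, one_mul, le_refl]

open Classical in
/-- The indicator of a property of histories. -/
noncomputable def ind (E : History n K L → Prop) (h : History n K L) : ℝ := if E h then 1 else 0

theorem ind_nonneg (E : History n K L → Prop) (h : History n K L) : 0 ≤ ind E h := by
  unfold ind; split_ifs <;> norm_num

theorem ind_of {E : History n K L → Prop} {h : History n K L} (hE : E h) : ind E h = 1 :=
  if_pos hE

theorem ind_of_not {E : History n K L → Prop} {h : History n K L} (hE : ¬E h) : ind E h = 0 :=
  if_neg hE

/-- After `h`, the sum of `f` over the pulls of `a` is outside the range that has probability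
`2 exp (-κ)` for a fixed number of pulls, when `f` is centered and `|f| ≤ b`. -/
def Deviates (f : Obs K L → ℝ) (b κ : ℝ) (a : Fin n) (h : History n K L) : Prop :=
  0 < pulls h a ∧ b * √(2 * κ * pulls h a) < |armSum f h a|

theorem trajE_ind_upper_le {a : Fin n} {f : Obs K L → ℝ} (hf : ∑ o, B.obsProb a o * f o = 0)
    {b : ℝ} (hb0 : 0 < b) (hb : ∀ o, |f o| ≤ b) {κ : ℝ} (hκ : 0 ≤ κ) {s : ℕ} (hs : 0 < s)
    (t : ℕ) :
    trajE B π t (ind fun h => pulls h a = s ∧ b * √(2 * κ * s) < armSum f h a)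
      ≤ Real.exp (-κ) := by
  have hs' : (0 : ℝ) < s := by exact_mod_cast hs
  -- This `θ` minimizes the exponent `s (θ b)² / 2 - θ b √(2 κ s)` of Chernoff's bound.
  set θ := √(2 * κ / s) / b with hθ
  have hθb : (θ * b) ^ 2 = 2 * κ / s := by
    rw [hθ, div_mul_cancel₀ _ hb0.ne', Real.sq_sqrt (by positivity)]
  have hprod : θ * (b * √(2 * κ * s)) = 2 * κ := by
    rw [← mul_assoc, hθ, div_mul_cancel₀ _ hb0.ne', ← Real.sqrt_mul (by positivity)]
    have : 2 * κ / s * (2 * κ * s) = (2 * κ) ^ 2 := by field_simp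
    rw [this, Real.sqrt_sq (by positivity)]
  have hle : ∀ h : History n K L,
      ind (fun h => pulls h a = s ∧ b * √(2 * κ * s) < armSum f h a) h ≤ Real.exp (-κ) *
        Real.exp (θ * armSum f h a - pulls h a * ((θ * b) ^ 2 / 2)) := by
    intro h
    unfold ind
    split_ifs with hE
    · rw [← Real.exp_add]
      refine Real.one_le_exp ?_
      have h1 : θ * (b * √(2 * κ * s)) ≤ θ * armSum f h a :=
        mul_le_mul_of_nonneg_left hE.2.le (by positivity)
      have h2 : (s : ℝ) * (2 * κ / s / 2) = κ := by field_simp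
      rw [hE.1, hθb, h2]
      linarith
    · positivity
  refine (trajE_mono B π (g' := fun h => Real.exp (-κ) *
    Real.exp (θ * armSum f h a - pulls h a * ((θ * b) ^ 2 / 2))) fun xs _ => hle _).trans ?_
  rw [trajE_const_mul]
  exact mul_le_of_le_one_right (Real.exp_pos _).le (trajE_exp_le_one π hf hb θ t)

/-- Hoeffding's inequality for the adaptively chosen pulls of one arm, with a union bound over the
number of pulls. -/
theorem trajE_ind_deviates_le {a : Fin n} {f : Obs K L → ℝ}
    (hf : ∑ o, B.obsProb a o * f o = 0) {b : ℝ} (hb0 : 0 < b) (hb : ∀ o, |f o| ≤ b) {κ : ℝ}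
    (hκ : 0 ≤ κ) (t : ℕ) :
    trajE B π t (ind (Deviates f b κ a)) ≤ 2 * t * Real.exp (-κ) := by
  set U : (Obs K L → ℝ) → ℕ → History n K L → ℝ := fun g s =>
    ind fun h => pulls h a = s ∧ b * √(2 * κ * s) < armSum g h a with hU
  have hneg : ∀ h, armSum (fun o => -f o) h a = -armSum f h a := by
    intro h
    simp only [← sum_count_mul, mul_neg, Finset.sum_neg_distrib]
  have hle : ∀ xs : List (Draw K L), xs.length = t → ind (Deviates f b κ a) (play π xs)
      ≤ ∑ s ∈ Finset.Icc 1 t, (U f s (play π xs) + U (fun o => -f o) s (play π xs)) := by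
    intro xs hxs
    set h := play π xs with hh
    have hnn : ∀ s ∈ Finset.Icc 1 t, 0 ≤ U f s h + U (fun o => -f o) s h := fun s _ =>
      add_nonneg (ind_nonneg _ _) (ind_nonneg _ _)
    by_cases hE : Deviates f b κ a h
    · have hmem : pulls h a ∈ Finset.Icc 1 t := by
        rw [Finset.mem_Icc]
        refine ⟨hE.1, ?_⟩
        rw [← hxs, ← length_play π xs]
        exact List.countP_le_length
      refine le_trans ?_ (Finset.single_le_sum hnn hmem)
      rw [ind_of hE]
      rcases lt_abs.1 hE.2 with h1 | h1
      · have e : U f (pulls h a) h = 1 := ind_of ⟨rfl, h1⟩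
        have h2 : 0 ≤ U (fun o => -f o) (pulls h a) h := ind_nonneg _ _
        linarith
      · have e : U (fun o => -f o) (pulls h a) h = 1 := ind_of ⟨rfl, by rwa [hneg]⟩
        have h2 : 0 ≤ U f (pulls h a) h := ind_nonneg _ _
        linarith
    · rw [ind_of_not hE]
      exact Finset.sum_nonneg hnn
  refine (trajE_mono B π (g' := fun h =>
    ∑ s ∈ Finset.Icc 1 t, (U f s h + U (fun o => -f o) s h)) hle).trans ?_
  rw [trajE_sum]
  have hterm : ∀ s ∈ Finset.Icc 1 t,
      trajE B π t (fun h => U f s h + U (fun o => -f o) s h) ≤ 2 * Real.exp (-κ) := by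
    intro s hs
    have hs : 0 < s := (Finset.mem_Icc.1 hs).1
    rw [trajE_add]
    have h1 := trajE_ind_upper_le π hf hb0 hb hκ hs t
    have h2 := trajE_ind_upper_le π (f := fun o => -f o) (a := a) (by simpa using hf) hb0
      (by simpa using hb) hκ hs t
    linarith
  refine (Finset.sum_le_sum hterm).trans (le_of_eq ?_)
  simp
  ring

end Concentration

/-! ### Validity of the confidence bounds -/

section Validity

variable {n K L : ℕ} {B : Bandit n K L} {C : Fin n → ℝ}

/-- Each arm has been pulled `N` times once the exploration rounds are over. -/
theorem le_pulls_play {π : Policy n K L} {N : ℕ}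
    (hπ : ∀ h : History n K L, h.length < n * N → (π h : ℕ) = h.length / N) (a : Fin n)
    {xs : List (Draw K L)} (hxs : n * N ≤ xs.length) : N ≤ pulls (play π xs) a := by
  have han : (a + 1) * N ≤ n * N := Nat.mul_le_mul_right N a.2
  rw [add_mul, one_mul] at han
  have key : ∀ xs : List (Draw K L), min N (xs.length - a * N) ≤ pulls (play π xs) a := by
    intro xs
    induction xs using List.reverseRecOn with
    | nil => simp
    | append_singleton xs d ih =>
      rw [play_concat, pulls_append, List.length_append, List.length_singleton]
      by_cases h1 : a * N ≤ xs.length ∧ xs.length < a * N + N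
      · have harm : π (play π xs) = a := by
          refine Fin.ext ?_
          rw [hπ _ (by rw [length_play]; omega), length_play]
          refine Nat.div_eq_of_lt_le h1.1 ?_
          rw [add_mul, one_mul]
          exact h1.2
        rw [if_pos harm]
        omega
      · split_ifs <;> omega
  have := key xs
  omega

theorem abs_sum_freq_mul_le {f : Obs K L → ℝ} {b κ : ℝ} {a : Fin n} {h : History n K L}
    (hs : 0 < pulls h a) (hdev : ¬Deviates f b κ a h) :
    |∑ o, freq h a o * f o| ≤ b * √(2 * κ / pulls h a) := by
  have hs' : (0 : ℝ) < pulls h a := by exact_mod_cast hs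
  have h1 : |armSum f h a| ≤ b * √(2 * κ * pulls h a) := by
    by_contra hlt
    exact hdev ⟨hs, not_le.1 hlt⟩
  rw [sum_freq_mul, abs_div, abs_of_pos hs', div_le_iff₀ hs', mul_assoc]
  have e : √(2 * κ / pulls h a) * pulls h a = √(2 * κ * pulls h a) := by
    have e1 : 2 * κ * (pulls h a : ℝ) = 2 * κ / pulls h a * (pulls h a : ℝ) ^ 2 := by field_simp
    rw [e1, Real.sqrt_mul' _ (sq_nonneg _), Real.sqrt_sq hs'.le]
  rwa [e]

/-- The centered indicator of the observation `o`. -/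
noncomputable def obsCentered (B : Bandit n K L) (a : Fin n) (o o' : Obs K L) : ℝ :=
  (if o' = o then 1 else 0) - B.obsProb a o

theorem sum_obsProb_mul_obsCentered (a : Fin n) (o : Obs K L) :
    ∑ o', B.obsProb a o' * obsCentered B a o o' = 0 := by
  simp [obsCentered, mul_sub, Finset.sum_sub_distrib, ← Finset.sum_mul, B.sum_obsProb]

theorem abs_obsCentered_le (a : Fin n) (o o' : Obs K L) : |obsCentered B a o o'| ≤ 1 := by
  have h0 := B.obsProb_nonneg a o
  have h1 := B.obsProb_le_one a o
  rw [obsCentered, abs_le]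
  split_ifs <;> constructor <;> linarith

theorem sum_freq_mul_obsCentered {a : Fin n} {h : History n K L} (hs : 0 < pulls h a)
    (o : Obs K L) : ∑ o', freq h a o' * obsCentered B a o o' = freq h a o - B.obsProb a o := by
  simp [obsCentered, mul_sub, Finset.sum_sub_distrib, ← Finset.sum_mul, sum_freq hs]

/-- The exponent of the deviation probabilities. With the range `4 ‖Θ†‖ / λ` of the centered
influence function, it gives deviations below the confidence width, and a union bound over rounds
and numbers of pulls remains affordable. -/
noncomputable def devExp (α : ℝ) (T : ℕ) : ℝ := 9 / 4 * α * Real.log T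

/-- The average influence function or some frequency of the arm `a` deviates too far. -/
def Bad (B : Bandit n K L) (κ : ℝ) (a : Fin n) (h : History n K L) : Prop :=
  Deviates (fun o => B.influence a o - B.mean a)
    (4 * infNorm (pinv (B.Theta a)) * (1 / B.lamMin a)) κ a h ∨
  ∃ o, Deviates (obsCentered B a o) 1 κ a h

theorem sqrt_devExp_div {α : ℝ} {T : ℕ} (s : ℝ) :
    √(2 * devExp α T / s) = 3 / 2 * √(2 * α * Real.log T / s) := by
  have e : 2 * devExp α T / s = (3 / 2) ^ 2 * (2 * α * Real.log T / s) := by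
    rw [devExp]; ring
  rw [e, Real.sqrt_mul (by positivity), Real.sqrt_sq (by norm_num)]

theorem sqrt_var_le_S (hpos : B.Positivity) (hind : B.IndepGivenMediator)
    (hcomp : B.Complete) (a : Fin n) :
    √(2 * ∑ m, B.p m a / (B.lam m a * B.gam m a)) ≤ B.S C a := by
  refine le_trans (Real.sqrt_le_sqrt ?_) (le_max_right _ _)
  have h := Bandit.sum_div_pos hpos hind hcomp a
  have e : ∑ m, 32 * B.p m a / (B.lam m a * B.gam m a)
      = 32 * ∑ m, B.p m a / (B.lam m a * B.gam m a) := by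
    rw [Finset.mul_sum]
    exact Finset.sum_congr rfl fun m _ => by ring
  rw [e]
  linarith

namespace Bandit

/-- Outside the bad event, the upper confidence bound is at least the mean and exceeds it by a
multiple of `S_a √(α log T / T_a)` at most. -/
theorem mean_le_ucb_le (hpos : B.Positivity) (hind : B.IndepGivenMediator) (hcomp : B.Complete)
    (hC : ∀ a, condNumber (B.Theta a) ≤ C a) {δ : ℝ}
    (hδ : ∀ a v, ‖v - B.obsProb a‖ < δ → B.Close C a v) {α : ℝ} (hα : 0 ≤ α) {T : ℕ}
    {a : Fin n} {h : History n K L} (hs : 0 < pulls h a) (hbad : ¬Bad B (devExp α T) a h)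
    (hR : 3 / 2 * √(2 * α * Real.log T / pulls h a) < δ) :
    B.mean a ≤ ucb h a B.value C α T ∧
      ucb h a B.value C α T ≤ B.mean a + 3 * B.S C a * √(2 * α * Real.log T / pulls h a) := by
  set R := √(2 * α * Real.log T / pulls h a) with hRdef
  set v := freq h a with hv
  have hR0 : 0 ≤ R := Real.sqrt_nonneg _
  have hlog : 0 ≤ Real.log T := Real.log_natCast_nonneg T
  obtain ⟨hb1, hb2⟩ := not_or.1 hbad
  rw [not_exists] at hb2
  have hnorm : ‖v - B.obsProb a‖ ≤ 3 / 2 * R := by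
    refine (pi_norm_le_iff_of_nonneg (by positivity)).2 fun o => ?_
    have := abs_sum_freq_mul_le hs (hb2 o)
    rwa [sum_freq_mul_obsCentered hs, one_mul, sqrt_devExp_div] at this
  have hinf : |∑ o, v o * B.influence a o - B.mean a|
      ≤ 4 * infNorm (pinv (B.Theta a)) * (1 / B.lamMin a) * (3 / 2 * R) := by
    have := abs_sum_freq_mul_le hs hb1
    simp only [mul_sub, Finset.sum_sub_distrib] at this
    rwa [← Finset.sum_mul, sum_freq hs, one_mul, sqrt_devExp_div] at this
  obtain ⟨hc1, hc2, hc3, hc4⟩ := hδ a v (hnorm.trans_lt hR)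
  have hW := mul_le_width hpos hind hcomp hC a
  have hW8 := eight_le_width hpos hind hcomp hC a
  have hWS := two_mul_width_le_S hpos hind hcomp hC a
  have hXS := sqrt_var_le_S (C := C) hpos hind hcomp a
  have hWR := mul_le_mul_of_nonneg_right hW hR0
  have h8R := mul_le_mul_of_nonneg_right hW8 hR0
  have hSR := mul_le_mul_of_nonneg_right hWS hR0
  have h2R := mul_le_mul_of_nonneg_left hc2 hR0
  have h3R := mul_le_mul_of_nonneg_left hc3 hR0
  have hsecond : √(α * Real.log T / 2 * (varOf v / pulls h a)) ≤ R * B.S C a := by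
    refine le_trans ?_ (mul_le_mul_of_nonneg_left hXS hR0)
    rw [hRdef, ← Real.sqrt_mul (by positivity)]
    refine Real.sqrt_le_sqrt ?_
    have : α * Real.log T / 2 * (varOf v / pulls h a)
        ≤ α * Real.log T / 2 *
          (8 * (∑ m, B.p m a / (B.lam m a * B.gam m a)) / pulls h a) := by gcongr
    refine this.trans (le_of_eq ?_)
    ring
  have hsecond0 := Real.sqrt_nonneg (α * Real.log T / 2 * (varOf v / pulls h a))
  rw [abs_le] at hc1 hinf
  rw [ucb_eq hs, ← hv, ← hRdef]
  constructor <;> linarith [hc1.1, hc1.2, hinf.1, hinf.2]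

end Bandit

theorem trajE_ind_bad_le (hval : ∀ j, |B.value j| ≤ 1) (hpos : B.Positivity)
    (hind : B.IndepGivenMediator) (hcomp : B.Complete) (π : Policy n K L) {κ : ℝ}
    (hκ : 0 ≤ κ) (a : Fin n) (t : ℕ) :
    trajE B π t (ind (Bad B κ a))
      ≤ (1 + Fintype.card (Obs K L)) * (2 * t * Real.exp (-κ)) := by
  set b := 4 * infNorm (pinv (B.Theta a)) * (1 / B.lamMin a) with hb
  have hb0 : 0 < b := by
    have := Bandit.one_le_infNorm_pinv hpos hind hcomp a
    have := Bandit.one_le_one_div_lamMin hpos hind hcomp a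
    positivity
  have hle : ∀ h, ind (Bad B κ a) h
      ≤ ind (Deviates (fun o => B.influence a o - B.mean a) b κ a) h
        + ∑ o, ind (Deviates (obsCentered B a o) 1 κ a) h := by
    intro h
    have h1 := ind_nonneg (Deviates (fun o => B.influence a o - B.mean a) b κ a) h
    have h2 : ∀ o ∈ Finset.univ, 0 ≤ ind (Deviates (obsCentered B a o) 1 κ a) h :=
      fun o _ => ind_nonneg _ h
    by_cases hE : Bad B κ a h
    · rw [ind_of hE]
      rcases hE with hE | ⟨o, hE⟩
      · rw [ind_of hE]
        linarith [Finset.sum_nonneg h2]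
      · have := Finset.single_le_sum h2 (Finset.mem_univ o)
        rw [ind_of hE] at this
        linarith
    · rw [ind_of_not hE]
      exact add_nonneg h1 (Finset.sum_nonneg h2)
  refine (trajE_mono B π (g' := fun h =>
    ind (Deviates (fun o => B.influence a o - B.mean a) b κ a) h
      + ∑ o, ind (Deviates (obsCentered B a o) 1 κ a) h) fun xs _ => hle _).trans ?_
  rw [trajE_add, trajE_sum]
  have h1 := trajE_ind_deviates_le (B := B) π (a := a) (f := fun o => B.influence a o - B.mean a)
    (by simp [mul_sub, Finset.sum_sub_distrib, ← Finset.sum_mul, B.sum_obsProb,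
          Bandit.sum_obsProb_mul_influence hpos hind hcomp])
    hb0 (Bandit.abs_influence_sub_mean_le hval hpos hind hcomp a) hκ t
  have h2 : ∑ o, trajE B π t (ind (Deviates (obsCentered B a o) 1 κ a))
      ≤ ∑ _o : Obs K L, 2 * t * Real.exp (-κ) :=
    Finset.sum_le_sum fun o _ => trajE_ind_deviates_le π (sum_obsProb_mul_obsCentered a o)
      one_pos (abs_obsCentered_le a o) hκ t
  rw [Finset.sum_const, Finset.card_univ, nsmul_eq_mul] at h2
  linarith

end Validity

/-! ### The regret bound -/

section Regret

variable {n K L : ℕ} {B : Bandit n K L}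

/-- The potential whose increments dominate `σ_a / √T_a` for the pulled arm `a`. -/
noncomputable def potential (σ : Fin n → ℝ) (h : History n K L) : ℝ :=
  ∑ a, 2 * σ a * √(pulls h a)

theorem potential_append (σ : Fin n → ℝ) (h : History n K L) (b : Fin n) (o : Obs K L) :
    potential σ (h ++ [(b, o)])
      = potential σ h + 2 * σ b * (√(pulls h b + 1) - √(pulls h b)) := by
  have : ∀ a, 2 * σ a * √(pulls (h ++ [(b, o)]) a) = 2 * σ a * √(pulls h a)
      + if b = a then 2 * σ a * (√(pulls h a + 1) - √(pulls h a)) else 0 := by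
    intro a
    rw [pulls_append]
    split_ifs
    · push_cast; ring
    · simp
  simp [potential, this, Finset.sum_add_distrib]

theorem div_sqrt_le_increment (k : ℕ) : 1 / √(k : ℝ) ≤ √2 * (2 * (√(k + 1 : ℝ) - √k)) := by
  rcases Nat.eq_zero_or_pos k with rfl | hk
  · simp
  have hk' : (1 : ℝ) ≤ k := by exact_mod_cast hk
  have hs : 0 < √(k : ℝ) := Real.sqrt_pos.2 (by linarith)
  have hle : √(k + 1 : ℝ) ≤ √2 * √k := by
    rw [← Real.sqrt_mul (by norm_num)]
    exact Real.sqrt_le_sqrt (by linarith)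
  have hge : √(k : ℝ) ≤ √(k + 1 : ℝ) := Real.sqrt_le_sqrt (by linarith)
  have h1 := Real.sq_sqrt (show (0 : ℝ) ≤ k by linarith)
  have h2 := Real.sq_sqrt (show (0 : ℝ) ≤ k + 1 by linarith)
  rw [div_le_iff₀ hs]
  have hd : 0 ≤ √(k + 1 : ℝ) - √k := by linarith
  -- `1 = (√(k+1) - √k) (√(k+1) + √k)`, and `√(k+1) + √k ≤ 2 √2 √k`.
  have hone : (1 : ℝ) = (√(k + 1 : ℝ) - √k) * (√(k + 1 : ℝ) + √k) := by
    linear_combination h1 - h2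
  have h1le : (1 : ℝ) ≤ √2 := Real.one_le_sqrt.2 (by norm_num)
  have hsum : √(k + 1 : ℝ) + √k ≤ 2 * (√2 * √k) := by nlinarith
  have := mul_le_mul_of_nonneg_left hsum hd
  linarith

theorem trajE_div_sqrt_pulls_le (π : Policy n K L) {σ : Fin n → ℝ} (hσ : ∀ a, 0 ≤ σ a)
    (t : ℕ) :
    trajE B π t (fun h => σ (π h) * (1 / √(pulls h (π h))))
      ≤ √2 * (trajE B π (t + 1) (potential σ) - trajE B π t (potential σ)) := by
  have h1 : trajE B π (t + 1) (potential σ) = trajE B π t (potential σ) + trajE B π t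
      (fun h => 2 * σ (π h) * (√(pulls h (π h) + 1) - √(pulls h (π h)))) := by
    rw [trajE_succ, ← trajE_add]
    simp only [potential_append, ← Finset.sum_mul, B.law_sum, one_mul]
  rw [h1, add_sub_cancel_left, ← trajE_const_mul]
  refine trajE_mono B π fun xs _ => ?_
  have := mul_le_mul_of_nonneg_left
    (div_sqrt_le_increment (pulls (play π xs) (π (play π xs)))) (hσ (π (play π xs)))
  linarith

theorem sum_pulls (h : History n K L) : ∑ a, pulls h a = h.length := by
  induction h using List.reverseRecOn with
  | nil => simp [pulls]
  | append_singleton h e ih =>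
    obtain ⟨b, o⟩ := e
    simp [pulls_append, Finset.sum_add_distrib, ih]

theorem potential_le (σ : Fin n → ℝ) (h : History n K L) :
    potential σ h ≤ 2 * √((∑ a, σ a ^ 2) * h.length) := by
  have hcs := Finset.sum_mul_sq_le_sq_mul_sq Finset.univ σ fun a => √(pulls h a : ℝ)
  simp only [Real.sq_sqrt (Nat.cast_nonneg _), ← Nat.cast_sum, sum_pulls] at hcs
  have e : potential σ h = 2 * ∑ a, σ a * √(pulls h a) := by
    rw [potential, Finset.mul_sum]
    exact Finset.sum_congr rfl fun a _ => by ring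
  rw [e]
  exact mul_le_mul_of_nonneg_left (Real.le_sqrt_of_sq_le hcs) (by norm_num)

theorem sum_trajE_div_sqrt_pulls_le (π : Policy n K L) {σ : Fin n → ℝ} (hσ : ∀ a, 0 ≤ σ a)
    (T : ℕ) :
    ∑ t ∈ Finset.range T, trajE B π t (fun h => σ (π h) * (1 / √(pulls h (π h))))
      ≤ √2 * (2 * √((∑ a, σ a ^ 2) * T)) := by
  refine (Finset.sum_le_sum fun t _ => trajE_div_sqrt_pulls_le (B := B) π hσ t).trans ?_
  rw [← Finset.mul_sum, Finset.sum_range_sub fun t => trajE B π t (potential σ)]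
  refine mul_le_mul_of_nonneg_left ?_ (Real.sqrt_nonneg _)
  have h0 : trajE B π 0 (potential σ) = 0 := by simp [trajE_zero, potential, pulls]
  have hT : trajE B π T (potential σ) ≤ 2 * √((∑ a, σ a ^ 2) * T) := by
    rw [← trajE_const B π T (2 * √((∑ a, σ a ^ 2) * T))]
    refine trajE_mono B π fun xs hxs => ?_
    have := potential_le σ (play π xs)
    rwa [length_play, hxs] at this
  linarith

/-- The regret bound with its lower-order terms: the exploration rounds and the bad events. -/
theorem expectedRegret_le {C : Fin n → ℝ} (hval : ∀ j, |B.value j| ≤ 1)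
    (hpos : B.Positivity) (hind : B.IndepGivenMediator) (hcomp : B.Complete)
    (hC : ∀ a, condNumber (B.Theta a) ≤ C a) {δ : ℝ}
    (hδ : ∀ a v, ‖v - B.obsProb a‖ < δ → B.Close C a v) {α : ℝ} (hα : 1 < α) {T : ℕ}
    (hT : 1 ≤ Real.log T) (hR : 3 / 2 * √(2 * α / Real.log T) < δ) {π : Policy n K L}
    (hπ : IsTwoStepUCB B.value C α T π) :
    expectedRegret B π T ≤ 12 * √(α * T * Real.log T * ∑ a, B.S C a ^ 2)
      + (2 * n * initPulls T + 4 * n * (1 + Fintype.card (Obs K L))) := by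
  set N := initPulls T with hN
  set κ := devExp α T with hκdef
  set M : ℝ := 1 + Fintype.card (Obs K L) with hM
  have hκ2 : 2 * Real.log T ≤ κ := by rw [hκdef, devExp]; nlinarith
  have hκ : 0 ≤ κ := by linarith
  have hS : ∀ a, 0 ≤ B.S C a := fun a =>
    (Real.sqrt_nonneg _).trans (le_max_right _ _)
  have hNlog : Real.log T ^ 2 ≤ N := Nat.le_ceil _
  have hpt : ∀ xs : List (Draw K L), n * N ≤ xs.length →
      B.gap (π (play π xs)) ≤ 3 * √(2 * α * Real.log T) *
        (B.S C (π (play π xs)) * (1 / √(pulls (play π xs) (π (play π xs)))))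
        + ∑ a, 2 * ind (Bad B κ a) (play π xs) := by
    intro xs hxs
    set h := play π xs with hh
    have hmain0 : 0 ≤ 3 * √(2 * α * Real.log T) *
        (B.S C (π h) * (1 / √(pulls h (π h)))) := by
      have := hS (π h)
      positivity
    by_cases hE : ∃ a, Bad B κ a h
    · obtain ⟨a, ha⟩ := hE
      have h1 := Finset.single_le_sum (f := fun a => 2 * ind (Bad B κ a) h)
        (fun a _ => mul_nonneg (by norm_num) (ind_nonneg _ _)) (Finset.mem_univ a)
      simp only [ind_of ha] at h1
      linarith [Bandit.gap_le_two hval (π h)]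
    · rw [not_exists] at hE
      have hNp : ∀ a, N ≤ pulls h a := fun a => le_pulls_play hπ.explore a hxs
      have hpl : ∀ a, Real.log T ^ 2 ≤ pulls h a := fun a =>
        hNlog.trans (by exact_mod_cast hNp a)
      have hps : ∀ a, 0 < pulls h a := fun a => by
        have : (0 : ℝ) < pulls h a := lt_of_lt_of_le (by positivity) (hpl a)
        exact_mod_cast this
      have hRa : ∀ a, 3 / 2 * √(2 * α * Real.log T / pulls h a) < δ := by
        intro a
        refine lt_of_le_of_lt ?_ hR
        have hle : 2 * α * Real.log T / pulls h a ≤ 2 * α / Real.log T := by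
          calc 2 * α * Real.log T / pulls h a ≤ 2 * α * Real.log T / Real.log T ^ 2 := by
                gcongr
                exact hpl a
            _ = 2 * α / Real.log T := by field_simp
        gcongr
      have hucb := fun a => Bandit.mean_le_ucb_le hpos hind hcomp hC hδ
        (by linarith : 0 ≤ α) (hps a) (hE a) (hRa a)
      have : Nonempty (Fin n) := ⟨π h⟩
      have hsup : ⨆ a, B.mean a
          ≤ B.mean (π h) + 3 * B.S C (π h) * √(2 * α * Real.log T / pulls h (π h)) :=
        ciSup_le fun a => (hucb a).1.trans
          ((hπ.exploit h (by rw [hh, length_play]; exact hxs) a).trans (hucb (π h)).2)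
      have hz : ∀ a, ind (Bad B κ a) h = 0 := fun a => ind_of_not (hE a)
      simp only [hz, mul_zero, Finset.sum_const_zero, add_zero]
      rw [Real.sqrt_div (by positivity)] at hsup
      rw [Bandit.gap]
      calc _ ≤ 3 * B.S C (π h) * (√(2 * α * Real.log T) / √(pulls h (π h))) := by linarith
        _ = _ := by ring
  have hround : ∀ t ∈ Finset.range T, trajE B π t (fun h => B.gap (π h))
      ≤ (if t < n * N then 2 else 0) + 3 * √(2 * α * Real.log T) *
          trajE B π t (fun h => B.S C (π h) * (1 / √(pulls h (π h))))
        + n * (2 * (M * (2 * T * Real.exp (-κ)))) := by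
    intro t ht
    have htT : (t : ℝ) ≤ T := by exact_mod_cast (Finset.mem_range.1 ht).le
    have hbadt : trajE B π t (fun h => ∑ a, 2 * ind (Bad B κ a) h)
        ≤ n * (2 * (M * (2 * T * Real.exp (-κ)))) := by
      rw [trajE_sum]
      calc _ ≤ ∑ _a : Fin n, 2 * (M * (2 * T * Real.exp (-κ))) := by
            refine Finset.sum_le_sum fun a _ => ?_
            rw [trajE_const_mul]
            refine mul_le_mul_of_nonneg_left ?_ (by norm_num)
            refine (trajE_ind_bad_le hval hpos hind hcomp π hκ a t).trans ?_
            gcongr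
        _ = _ := by simp
    refine le_trans ?_ (add_le_add_right hbadt _)
    have hconst := trajE_const B π t (if t < n * N then (2 : ℝ) else 0)
    rw [← hconst, ← trajE_const_mul, ← trajE_add, ← trajE_add]
    refine trajE_mono B π fun xs hxs => ?_
    have hbad0 : 0 ≤ ∑ a, 2 * ind (Bad B κ a) (play π xs) :=
      Finset.sum_nonneg fun a _ => mul_nonneg (by norm_num) (ind_nonneg _ _)
    by_cases htN : t < n * N
    · have := hS (π (play π xs))
      have hmain0 : 0 ≤ 3 * √(2 * α * Real.log T) * (B.S C (π (play π xs)) *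
          (1 / √(pulls (play π xs) (π (play π xs))))) := by positivity
      simp only [htN, if_true]
      linarith [Bandit.gap_le_two hval (π (play π xs))]
    · simp only [htN, if_false, zero_add]
      exact hpt xs (by omega)
  rw [expectedRegret_eq_sum]
  refine (Finset.sum_le_sum hround).trans ?_
  rw [Finset.sum_add_distrib, Finset.sum_add_distrib, ← Finset.mul_sum, Finset.sum_const,
    Finset.card_range, nsmul_eq_mul]
  have hexplore : ∑ t ∈ Finset.range T, (if t < n * N then (2 : ℝ) else 0) ≤ 2 * n * N := by
    rw [← Finset.sum_filter, Finset.sum_const, nsmul_eq_mul]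
    have hcard : ((Finset.range T).filter fun t => t < n * N).card ≤ n * N := by
      refine (Finset.card_le_card (t := Finset.range (n * N)) fun t ht => ?_).trans_eq
        (Finset.card_range _)
      exact Finset.mem_range.2 (Finset.mem_filter.1 ht).2
    have : (((Finset.range T).filter fun t => t < n * N).card : ℝ) ≤ n * N := by
      exact_mod_cast hcard
    linarith
  have hmain : 3 * √(2 * α * Real.log T) * ∑ t ∈ Finset.range T,
      trajE B π t (fun h => B.S C (π h) * (1 / √(pulls h (π h))))
      ≤ 12 * √(α * T * Real.log T * ∑ a, B.S C a ^ 2) := by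
    have h1 := sum_trajE_div_sqrt_pulls_le (B := B) π hS T
    refine (mul_le_mul_of_nonneg_left h1 (by positivity)).trans (le_of_eq ?_)
    have hSS : 0 ≤ ∑ a, B.S C a ^ 2 := Finset.sum_nonneg fun a _ => sq_nonneg _
    have e1 : √(2 * α * Real.log T) = √2 * √(α * Real.log T) := by
      rw [mul_assoc, Real.sqrt_mul (by norm_num)]
    have e2 : √(α * T * Real.log T * ∑ a, B.S C a ^ 2)
        = √(α * Real.log T) * √((∑ a, B.S C a ^ 2) * T) := by
      rw [← Real.sqrt_mul (by positivity)]
      congr 1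
      ring
    rw [e1, e2]
    have := Real.mul_self_sqrt (show (0 : ℝ) ≤ 2 by norm_num)
    linear_combination 6 * √(α * Real.log T) * √((∑ a, B.S C a ^ 2) * T) * this
  have hTpos : (0 : ℝ) < T := by
    rcases Nat.eq_zero_or_pos T with rfl | h
    · simp at hT
      linarith
    · exact_mod_cast h
  have hbad : (T : ℝ) * (n * (2 * (M * (2 * T * Real.exp (-κ))))) ≤ 4 * n * M := by
    have hexp : (T : ℝ) ^ 2 * Real.exp (-κ) ≤ 1 := by
      have : (T : ℝ) ^ 2 = Real.exp (2 * Real.log T) := by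
        rw [two_mul, Real.exp_add, Real.exp_log hTpos, sq]
      rw [this, ← Real.exp_add]
      exact Real.exp_le_one_iff.2 (by linarith)
    have := mul_le_mul_of_nonneg_left hexp (show 0 ≤ 4 * n * M by positivity)
    linarith
  linarith

/-- The lower-order terms of the regret are `O(log(T)²)`, hence below the main term for large `T`. -/
theorem exists_forall_expectedRegret_le {C : Fin n → ℝ} (hval : ∀ j, |B.value j| ≤ 1)
    (hpos : B.Positivity) (hind : B.IndepGivenMediator) (hcomp : B.Complete)
    (hC : ∀ a, condNumber (B.Theta a) ≤ C a) {α : ℝ} (hα : 1 < α) :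
    ∃ T₀ : ℕ, ∀ T : ℕ, T₀ ≤ T → ∀ π : Policy n K L, IsTwoStepUCB B.value C α T π →
      expectedRegret B π T ≤ 13 * √(α * T * Real.log T * ∑ a, B.S C a ^ 2) := by
  obtain ⟨δ, hδ0, hδ⟩ := Bandit.exists_forall_close hpos hind hcomp hC
  set A : ℝ := 4 * n + 4 * n * (1 + Fintype.card (Obs K L)) with hA
  have hlog : Tendsto (fun T : ℕ => Real.log T) atTop atTop :=
    Real.tendsto_log_atTop.comp tendsto_natCast_atTop_atTop
  have hsmall : Tendsto (fun T : ℕ => 3 / 2 * √(2 * α / Real.log T)) atTop (𝓝 0) := by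
    have h1 : Tendsto (fun T : ℕ => 2 * α / Real.log T) atTop (𝓝 0) := hlog.const_div_atTop _
    simpa using h1.sqrt.const_mul (3 / 2)
  have hpow : ∀ᶠ T : ℕ in atTop, A ^ 2 * Real.log T ^ 4 ≤ T := by
    have h1 := ((Real.isLittleO_pow_log_id_atTop (n := 4)).comp_tendsto
      (tendsto_natCast_atTop_atTop (R := ℝ))).def (c := 1 / (A ^ 2 + 1)) (by positivity)
    filter_upwards [h1] with T hT
    simp only [Function.comp_apply, id, norm_pow, Real.norm_eq_abs, Nat.abs_cast] at hT
    rw [abs_of_nonneg (Real.log_natCast_nonneg T), one_div, ← div_eq_inv_mul,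
      le_div_iff₀ (by positivity)] at hT
    nlinarith [pow_nonneg (Real.log_natCast_nonneg T) 4]
  obtain ⟨T₀, hT₀⟩ := eventually_atTop.1
    ((hlog.eventually_ge_atTop 1).and ((hsmall.eventually_lt_const hδ0).and hpow))
  refine ⟨T₀, fun T hT π hπ => ?_⟩
  obtain ⟨hT1, hTδ, hTA⟩ := hT₀ T hT
  refine (expectedRegret_le hval hpos hind hcomp hC hδ hα hT1 hTδ hπ).trans ?_
  have hN : (initPulls T : ℝ) ≤ Real.log T ^ 2 + 1 :=
    (Nat.ceil_lt_add_one (sq_nonneg _)).le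
  have hlog2 : 1 ≤ Real.log T ^ 2 := one_le_pow₀ hT1
  have hlow : 2 * n * initPulls T + 4 * n * (1 + Fintype.card (Obs K L))
      ≤ A * Real.log T ^ 2 := by
    have h1 : (2 * n : ℝ) * initPulls T ≤ 2 * n * (2 * Real.log T ^ 2) := by
      gcongr
      linarith
    have h2 : (4 * n * (1 + Fintype.card (Obs K L)) : ℝ) * 1
        ≤ 4 * n * (1 + Fintype.card (Obs K L)) * Real.log T ^ 2 := by gcongr
    rw [hA]
    linarith
  have hsqrt : A * Real.log T ^ 2 ≤ √T := by
    refine Real.le_sqrt_of_sq_le ?_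
    calc _ = A ^ 2 * Real.log T ^ 4 := by ring
      _ ≤ T := hTA
  -- An arm exists, since the policy pulls one; its complexity is at least `1`.
  have hSS : 1 ≤ ∑ a, B.S C a ^ 2 := by
    have h1 : 1 ≤ B.S C (π []) := by
      linarith [Bandit.eight_le_width hpos hind hcomp hC (π []),
        Bandit.two_mul_width_le_S hpos hind hcomp hC (π [])]
    exact (one_le_pow₀ h1).trans (Finset.single_le_sum (f := fun a => B.S C a ^ 2)
      (fun a _ => sq_nonneg _) (Finset.mem_univ _))
  have hfin : √(T : ℝ) ≤ √(α * T * Real.log T * ∑ a, B.S C a ^ 2) := by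
    refine Real.sqrt_le_sqrt ?_
    have h1 : 1 ≤ α * Real.log T * ∑ a, B.S C a ^ 2 :=
      one_le_mul_of_one_le_of_one_le (one_le_mul_of_one_le_of_one_le hα.le hT1) hSS
    calc (T : ℝ) = T * 1 := (mul_one _).symm
      _ ≤ T * (α * Real.log T * ∑ a, B.S C a ^ 2) :=
        mul_le_mul_of_nonneg_left h1 (Nat.cast_nonneg T)
      _ = _ := by ring
  linarith

end Regret

end MissingBandit

theorem mainTheorem9 :
    ∃ c : ℝ, 0 < c ∧
      ∀ (n K L : ℕ) (B : MissingBandit.Bandit n K L) (C : Fin n → ℝ),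
        (∀ j, |B.value j| ≤ 1) →
        B.Positivity →
        B.IndepGivenMediator →
        B.Complete →
        (∀ a, MissingBandit.condNumber (B.Theta a) ≤ C a) →
        ∀ α : ℝ, 1 < α →
          ∃ T₀ : ℕ, ∀ T : ℕ, T₀ ≤ T →
            ∀ π : MissingBandit.Policy n K L,
              MissingBandit.IsTwoStepUCB B.value C α T π →
              MissingBandit.expectedRegret B π T ≤
                c * √(α * T * Real.log T * ∑ a, B.S C a ^ 2) :=
  ⟨13, by norm_num, fun _ _ _ _ _ hval hpos hind hcomp hC _ hα =>
    MissingBandit.exists_forall_expectedRegret_le hval hpos hind hcomp hC hα⟩
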